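/- **Setting.** Let $X$ be a complex manifold of dimension $d$, $D\subset X$ a normal crossing divisor, $U=X\setminus D$ and $\iota:U\to X$ the inclusion. An open coordinate set $V\subseteq X$ with holomorphic coordinates $z_1,\dots,z_d$, $r_i=|z_i|$, is *adapted to $D$* if $D\cap V$ is given by $z_1\cdots z_k=0$ (for some $0\le k\le d$) and $r_i\le 1/e^{e}$ on $V$ for all $i$. For non-negative functions, $f\prec g$ means $f\le C g$ for some constant $C>0$. **Log-log forms.** Let $V$ be adapted to $D$. A smooth function $f$ on $V\setminus D$ has *log-log growth of infinite order* if for every $K\ge 0$ there is an integer $N_K$ such that, for all multi-indices $\alpha,\beta\in\mathbb Z_{\ge0}^d$ with $|\alpha+\beta|\le K$, on $V\setminus D$, $$\Big|\frac{\partial^{|\alpha|}}{\partial z^{\alpha}}\frac{\partial^{|\beta|}}{\partial\bar z^{\beta}}f\Big|\prec\frac{\big|\prod_{i=1}^k\log\log(1/r_i)\big|^{N_K}}{\prod_{i=1}^k r_i^{\alpha_i+\beta_i}} .$$ Let $W\subseteq X$ be open. A smooth form on $W\cap U$ has *log-log growth along $D$ of infinite order* if every point of $W$ has an adapted coordinate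 neighbourhood $V\subseteq W$ such that on $V\setminus D$ the form lies in the algebra generated by the functions with log-log growth of infinite order and the differentials $\frac{dz_i}{z_i\log(1/r_i)},\frac{d\bar z_i}{\bar z_i\log(1/r_i)}$ for $i\le k$, and $dz_i,d\bar z_i$ for $i>k$. A smooth form $\omega$ on $W\cap U$ is *log-log along $D$* if $\omega$, $\partial\omega$, $\bar\partial\omega$ and $\partial\bar\partial\omega$ all have log-log growth along $D$ of infinite order. **Logarithmic growth in the local universal cover.** For $M>1$ let $U_M=\{x\in\mathbb C:\operatorname{Im}x>M\}$ and let $K\subseteq\mathbb C^{d-k}$ be open. A smooth function $g$ on $(U_M)^k\times K$ has *imaginary logarithmic growth* if there are integers $N_n$, $n\ge0$, such that for all $\alpha,\beta\in\mathbb Z_{\ge0}^d$ $$\Big|\frac{\partial^{|\alpha|}}{\partial x^{\alpha}}\frac{\partial^{|\beta|}}{\partial\bar x^{\beta}}g\Big|\prec\frac{\big|\prod_{i=1}^k\log(\operatorname{Im}x_i)\big|^{N_{|\alpha|+|\beta|}}}{\prod_{i=1}^k(\operatorname{Im}x_i)^{\alpha_i+\beta_i}} .$$ A form on $(U_M)^k\times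 K$ has imaginary logarithmic growth if it lies in the algebra generated by these functions and the differentials $\frac{dx_i}{\operatorname{Im}x_i},\frac{d\bar x_i}{\operatorname{Im}x_i}$ for $i\le k$, and $dx_i,d\bar x_i$ for $i>k$. A smooth form $\omega$ on $W\cap U$ has *logarithmic growth in the local universal cover* if every $p\in W$ has an adapted coordinate neighbourhood $V\subseteq W$, with $z_1(p)=\dots=z_k(p)=0$ and with coordinates identifying $V$ with $(\Delta_r)^k\times K$, where $r>0$, $\Delta_r=\{|z|<r\}$ and $K\subseteq\mathbb C^{d-k}$ is open, and a real number $M>\max(1,\log(1/r))$, such that for $$\pi:(U_M)^k\times K\to V,\qquad \pi(x)=(e^{2\pi i x_1},\dots,e^{2\pi i x_k},x_{k+1},\dots,x_d),$$ the form $\pi^*\omega$ has imaginary logarithmic growth. **Theorem.** The sheaf of differential forms with logarithmic growth in the local universal cover is contained in the sheaf of log-log forms: for every open $W\subseteq X$ and every $n\ge 0$, every smooth $n$-form on $W\setminus D$ that has logarithmic growth in the local universal cover is log-log along $D$. -/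

import Mathlib

open scoped ContDiff Manifold

noncomputable section

namespace LogLog

/-- The model space `ℂ^d`, with coordinates `z 0, …, z (d - 1)`. -/
abbrev Cn (d : ℕ) : Type := Fin d → ℂ

/-! ### Wirtinger derivatives and multi-indices -/

/-- `∂f/∂z_i = (∂f/∂x_i - √-1 ∂f/∂y_i) / 2`. -/
def wirtZ {d : ℕ} (i : Fin d) (f : Cn d → ℂ) (z : Cn d) : ℂ :=
  (fderiv ℝ f z (Pi.single i 1) - Complex.I * fderiv ℝ f z (Pi.single i Complex.I)) / 2

/-- `∂f/∂z̄_i = (∂f/∂x_i + √-1 ∂f/∂y_i) / 2`. -/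
def wirtZbar {d : ℕ} (i : Fin d) (f : Cn d → ℂ) (z : Cn d) : ℂ :=
  (fderiv ℝ f z (Pi.single i 1) + Complex.I * fderiv ℝ f z (Pi.single i Complex.I)) / 2

/-- `∂^{|α|}/∂z^α ∂^{|β|}/∂z̄^β f` for multi-indices `α`, `β`. -/
def mixedDeriv {d : ℕ} (α β : Fin d → ℕ) (f : Cn d → ℂ) : Cn d → ℂ :=
  (List.finRange d).foldr (fun i g => (wirtZ i)^[α i] g)
    ((List.finRange d).foldr (fun i g => (wirtZbar i)^[β i] g) f)

/-! ### Complex differential forms on open subsets of `ℂ^d` -/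

/-- Complex valued, real alternating `n`-forms on the real vector space `ℂ^d`. -/
abbrev AltForm (d n : ℕ) : Type := Cn d [⋀^Fin n]→L[ℝ] ℂ

/-- The covector `dz_i`. -/
def dz {d : ℕ} (i : Fin d) : Cn d →L[ℝ] ℂ := ContinuousLinearMap.proj i

/-- The covector `dz̄_i`. -/
def dzbar {d : ℕ} (i : Fin d) : Cn d →L[ℝ] ℂ :=
  (Complex.conjCLE : ℂ →L[ℝ] ℂ).comp (dz i)

/-- The wedge product `η_1 ∧ ⋯ ∧ η_n` of `n` covectors: its value on `(v_1, …, v_n)` is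
`det (η_i (v_j))`. For `n = 0` it is the constant `1`. -/
def wedge {d n : ℕ} (η : Fin n → (Cn d →L[ℝ] ℂ)) : AltForm d n :=
  ContinuousMultilinearMap.alternatization
    ((ContinuousMultilinearMap.mkPiAlgebra ℝ (Fin n) ℂ).compContinuousLinearMap η)

/-- Multiplication by `√-1` on `ℂ^d`, as a real linear map. -/
def mulI (d : ℕ) : Cn d →L[ℝ] Cn d :=
  (Complex.I • ContinuousLinearMap.id ℂ (Cn d)).restrictScalars ℝ

/-- The operator `∂` on `n`-forms on `ℂ^d`. If `L` is the derivative of the map `η`, then `dη` is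
the antisymmetrization of `L`, and `∂η` is the antisymmetrization of the complex linear part
`v ↦ (L v - √-1 L (√-1 v)) / 2` of `L`. In coordinates,
`∂ (f dz_I ∧ dz̄_J) = ∑_i (∂f/∂z_i) dz_i ∧ dz_I ∧ dz̄_J`. -/
def del {d n : ℕ} (η : Cn d → AltForm d n) (z : Cn d) : AltForm d (n + 1) :=
  ContinuousAlternatingMap.alternatizeUncurryFin
    ((1 / 2 : ℂ) • (fderiv ℝ η z - Complex.I • (fderiv ℝ η z).comp (mulI d)))

/-- The operator `∂̄` on `n`-forms on `ℂ^d`: as `del`, with the complex antilinear part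
`v ↦ (L v + √-1 L (√-1 v)) / 2`. -/
def delbar {d n : ℕ} (η : Cn d → AltForm d n) (z : Cn d) : AltForm d (n + 1) :=
  ContinuousAlternatingMap.alternatizeUncurryFin
    ((1 / 2 : ℂ) • (fderiv ℝ η z + Complex.I • (fderiv ℝ η z).comp (mulI d)))

/-- The degree `n` part of the algebra of differential forms on `S` that is generated by an algebra
`A` of functions and by the `1`-forms `ξ (i, false)`, `ξ (i, true)`: on `S`, the form `η` is a sum
of products `f · ξ_{s 1} ∧ ⋯ ∧ ξ_{s n}` with `f` in `A`. -/
def IsGeneratedBy {d n : ℕ} (A : Set (Cn d → ℂ)) (ξ : Fin d × Bool → Cn d → (Cn d →L[ℝ] ℂ))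
    (S : Set (Cn d)) (η : Cn d → AltForm d n) : Prop :=
  ∃ f : (Fin n → Fin d × Bool) → Cn d → ℂ, (∀ s, f s ∈ A) ∧
    ∀ z ∈ S, η z = ∑ s : Fin n → Fin d × Bool, f s z • wedge (fun j => ξ (s j) z)

/-- The set of indices `i < k`. -/
def divIdx (d k : ℕ) : Finset (Fin d) := Finset.univ.filter (fun i => (i : ℕ) < k)

/-! ### Log-log growth in coordinates

The divisor is given by `z_1 ⋯ z_k = 0`, i.e. it involves the coordinates `i` with `i < k`. -/

/-- The bound of order `K` in the definition of log-log growth, on the set `S`. -/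
def HasLogLogGrowthOfOrder {d : ℕ} (k : ℕ) (S : Set (Cn d)) (K : ℕ) (f : Cn d → ℂ) : Prop :=
  ∃ N : ℕ, ∀ α β : Fin d → ℕ, (∑ i, (α i + β i)) ≤ K →
    ∃ C : ℝ, 0 < C ∧ ∀ z ∈ S,
      ‖mixedDeriv α β f z‖ ≤
        C * (|∏ i ∈ divIdx d k, Real.log (Real.log (1 / ‖z i‖))| ^ N /
          ∏ i ∈ divIdx d k, ‖z i‖ ^ (α i + β i))

/-- The smooth functions on `S` with log-log growth of infinite order. -/
def logLogFunctions {d : ℕ} (k : ℕ) (S : Set (Cn d)) : Set (Cn d → ℂ) :=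
  {f | ContDiffOn ℝ ∞ f S ∧ ∀ K : ℕ, HasLogLogGrowthOfOrder k S K f}

/-- The differentials `dz_i / (z_i log (1/|z_i|))`, `dz̄_i / (z̄_i log (1/|z_i|))` for `i < k` and
`dz_i`, `dz̄_i` for the other `i`. -/
def logLogFrame {d : ℕ} (k : ℕ) (a : Fin d × Bool) (z : Cn d) : Cn d →L[ℝ] ℂ :=
  match a with
  | (i, false) =>
      if (i : ℕ) < k then (1 / (z i * (Real.log (1 / ‖z i‖) : ℂ))) • dz i else dz i
  | (i, true) =>
      if (i : ℕ) < k then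
        (1 / ((starRingEnd ℂ) (z i) * (Real.log (1 / ‖z i‖) : ℂ))) • dzbar i
      else dzbar i

/-- A form on `S` in the algebra generated by the functions with log-log growth of infinite order
and the differentials `logLogFrame`. -/
def HasLogLogGrowthOn {d n : ℕ} (k : ℕ) (S : Set (Cn d)) (η : Cn d → AltForm d n) : Prop :=
  IsGeneratedBy (logLogFunctions k S) (logLogFrame k) S η

/-! ### Imaginary logarithmic growth -/

/-- `(Δ_r)^k × K ⊆ ℂ^d`. -/
def polydiscProd {d : ℕ} (k : ℕ) (r : ℝ) (K : Set ({i : Fin d // k ≤ (i : ℕ)} → ℂ)) :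
    Set (Cn d) :=
  {z | (∀ i : Fin d, (i : ℕ) < k → ‖z i‖ < r) ∧ (fun i : {i : Fin d // k ≤ (i : ℕ)} => z i) ∈ K}

/-- `(U_M)^k × K ⊆ ℂ^d`, where `U_M` is the half plane `Im x > M`. -/
def halfPlaneProd {d : ℕ} (k : ℕ) (M : ℝ) (K : Set ({i : Fin d // k ≤ (i : ℕ)} → ℂ)) :
    Set (Cn d) :=
  {x | (∀ i : Fin d, (i : ℕ) < k → M < (x i).im) ∧
    (fun i : {i : Fin d // k ≤ (i : ℕ)} => x i) ∈ K}

/-- `π (x_1, …, x_d) = (exp (2 π √-1 x_1), …, exp (2 π √-1 x_k), x_{k+1}, …, x_d)`. -/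
def expCover {d : ℕ} (k : ℕ) (x : Cn d) : Cn d :=
  fun i => if (i : ℕ) < k then Complex.exp (2 * Real.pi * Complex.I * x i) else x i

/-- The smooth functions on `S` with imaginary logarithmic growth. -/
def imLogFunctions {d : ℕ} (k : ℕ) (S : Set (Cn d)) : Set (Cn d → ℂ) :=
  {f | ContDiffOn ℝ ∞ f S ∧
    ∃ N : ℕ → ℕ, ∀ α β : Fin d → ℕ, ∃ C : ℝ, 0 < C ∧ ∀ x ∈ S,
      ‖mixedDeriv α β f x‖ ≤
        C * (|∏ i ∈ divIdx d k, Real.log (x i).im| ^ N (∑ i, (α i + β i)) /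
          ∏ i ∈ divIdx d k, (x i).im ^ (α i + β i))}

/-- The differentials `dx_i / Im x_i`, `dx̄_i / Im x_i` for `i < k` and `dx_i`, `dx̄_i` for the
other `i`. -/
def imLogFrame {d : ℕ} (k : ℕ) (a : Fin d × Bool) (x : Cn d) : Cn d →L[ℝ] ℂ :=
  match a with
  | (i, false) => if (i : ℕ) < k then (1 / ((x i).im : ℂ)) • dz i else dz i
  | (i, true) => if (i : ℕ) < k then (1 / ((x i).im : ℂ)) • dzbar i else dzbar i

/-- A form on `S` with imaginary logarithmic growth. -/
def HasImLogGrowthOn {d n : ℕ} (k : ℕ) (S : Set (Cn d)) (η : Cn d → AltForm d n) : Prop :=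
  IsGeneratedBy (imLogFunctions k S) (imLogFrame k) S η

/-- The pull-back `π^* η`. -/
def pullbackExp {d n : ℕ} (k : ℕ) (η : Cn d → AltForm d n) (x : Cn d) : AltForm d n :=
  (η (expCover k x)).compContinuousLinearMap (fderiv ℝ (expCover k) x)

/-! ### Complex manifolds, normal crossing divisors and differential forms -/

variable {d : ℕ} {X : Type*} [TopologicalSpace X] [ChartedSpace (Cn d) X]

/-- `φ` is a holomorphic coordinate system on its domain `V`, and `D ∩ V` has the equation
`z_1 ⋯ z_k = 0`. -/
def IsDivisorChart (D : Set X) (k : ℕ) (φ : OpenPartialHomeomorph X (Cn d)) : Prop :=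
  φ ∈ IsManifold.maximalAtlas 𝓘(ℂ, Cn d) ω X ∧ k ≤ d ∧
    ∀ x ∈ φ.source, x ∈ D ↔ ∏ i ∈ divIdx d k, φ x i = 0

/-- `D` is (the support of) a normal crossing divisor of `X`. -/
def IsNormalCrossingDivisor (d : ℕ) {X : Type*} [TopologicalSpace X] [ChartedSpace (Cn d) X]
    (D : Set X) : Prop :=
  ∀ p : X, ∃ (k : ℕ) (φ : OpenPartialHomeomorph X (Cn d)),
    p ∈ φ.source ∧ IsDivisorChart D k φ

/-- A coordinate neighbourhood adapted to `D`: moreover all coordinates are at most `1/e^e` in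
absolute value. -/
def IsAdaptedChart (D : Set X) (k : ℕ) (φ : OpenPartialHomeomorph X (Cn d)) : Prop :=
  IsDivisorChart D k φ ∧
    ∀ x ∈ φ.source, ∀ i : Fin d, ‖φ x i‖ ≤ 1 / Real.exp (Real.exp 1)

/-- The image of `V \ D` in the coordinates `φ` on `V`. -/
def complementIn (D : Set X) (φ : OpenPartialHomeomorph X (Cn d)) : Set (Cn d) :=
  {z | z ∈ φ.target ∧ φ.symm z ∉ D}

/-- Complex valued differential `n`-forms on `X`, with no regularity. For sections over an open set
`W \ D` only the values at the points of `W \ D` matter. -/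
abbrev DForm (d : ℕ) (X : Type*) [TopologicalSpace X] [ChartedSpace (Cn d) X] (n : ℕ) : Type _ :=
  (x : X) → (TangentSpace 𝓘(ℝ, Cn d) x) [⋀^Fin n]→L[ℝ] ℂ

/-- The expression of a form in the coordinates `φ`, that is, its pull-back by `φ⁻¹`. -/
def localExpr {n : ℕ} (η : DForm d X n) (φ : OpenPartialHomeomorph X (Cn d)) (z : Cn d) :
    AltForm d n :=
  (η (φ.symm z)).compContinuousLinearMap
    (mfderiv 𝓘(ℝ, Cn d) 𝓘(ℝ, Cn d) φ.symm z : Cn d →L[ℝ] TangentSpace 𝓘(ℝ, Cn d) (φ.symm z))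

/-- `η` is a smooth form on `W \ D`, i.e. a section over `W` of `ι_* ℰ_U^n` with `U = X \ D`. -/
def IsSmoothForm (D W : Set X) {n : ℕ} (η : DForm d X n) : Prop :=
  ∀ φ ∈ IsManifold.maximalAtlas 𝓘(ℂ, Cn d) ω X,
    ContDiffOn ℝ ∞ (localExpr η φ) {z | z ∈ φ.target ∧ φ.symm z ∈ W \ D}

/-- A form on `W \ D`, given by its expressions `η φ` in holomorphic coordinates `φ`, is a section
over `W` of the sheaf of algebras of forms with log-log growth along `D` of infinite order: every
point of `W` has an adapted coordinate neighbourhood `V ⊆ W` such that the form is, on `V \ D`, in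
the algebra generated by the functions with log-log growth and the log-log differentials. -/
def HasLogLogGrowth (D W : Set X) {n : ℕ}
    (η : OpenPartialHomeomorph X (Cn d) → Cn d → AltForm d n) : Prop :=
  ∀ p ∈ W, ∃ (k : ℕ) (φ : OpenPartialHomeomorph X (Cn d)),
    IsAdaptedChart D k φ ∧ p ∈ φ.source ∧ φ.source ⊆ W ∧
      HasLogLogGrowthOn k (complementIn D φ) (η φ)

/-- The sections over `W` of the sheaf of `n`-forms that are log-log along `D`: the smooth forms
`η` on `W \ D` such that `η`, `∂η`, `∂̄η` and `∂∂̄η` have log-log growth along `D` of infinite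
order. -/
def logLogForms (D W : Set X) (n : ℕ) : Set (DForm d X n) :=
  {η | IsSmoothForm D W η ∧
    HasLogLogGrowth D W (fun φ => localExpr η φ) ∧
    HasLogLogGrowth D W (fun φ => del (localExpr η φ)) ∧
    HasLogLogGrowth D W (fun φ => delbar (localExpr η φ)) ∧
    HasLogLogGrowth D W (fun φ => del (delbar (localExpr η φ)))}

/-- The sections over `W` of the sheaf of `n`-forms with logarithmic growth in the local universal
cover: the smooth forms `η` on `W \ D` such that every point `p` of `W` has an adapted coordinate
neighbourhood `V ⊆ W`, with `V = (Δ_r)^k × K` in coordinates whose first `k` vanish at `p`, and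
some `M > log (1/r)`, for which the pull-back of `η` to `(U_M)^k × K` has imaginary logarithmic
growth. -/
def univCoverLogForms (D W : Set X) (n : ℕ) : Set (DForm d X n) :=
  {η | IsSmoothForm D W η ∧
    ∀ p ∈ W, ∃ (k : ℕ) (φ : OpenPartialHomeomorph X (Cn d)) (r M : ℝ)
      (K : Set ({i : Fin d // k ≤ (i : ℕ)} → ℂ)),
      IsAdaptedChart D k φ ∧ p ∈ φ.source ∧ φ.source ⊆ W ∧
      (∀ i : Fin d, (i : ℕ) < k → φ p i = 0) ∧
      0 < r ∧ IsOpen K ∧ φ.target = polydiscProd k r K ∧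
      1 < M ∧ Real.log (1 / r) < M ∧
      HasImLogGrowthOn k (halfPlaneProd k M K) (pullbackExp k (localExpr η φ))}

end LogLog

end

noncomputable section

namespace LogLog

/-! ### Wirtinger calculus -/

section Wirtinger

variable {d : ℕ}

/-! Attach a weight c_a to each index a, that is, to each dz_i and dz̄_i. Call a smooth function
tame if every word in the operators c_a ∂_a sends it to a function bounded by a power of a fixed
gauge P ≥ 1. Tame functions form an algebra stable under these operators.

On the half planes the weights are Im x_i. On the punctured polydisc they are z_i log(1/|z_i|) and
conjugates. For i ≥ k they are 1. Since log(1/|e^{2πix}|) = 2π Im x, the chain rule turns z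
log(1/|z|) ∂_z into -√-1 Im x ∂_x, and similarly for conjugates (`logLogWeight_expCover`). As π is
onto the punctured polydisc of radius e^{-2πM}, tameness of g ∘ π gives tameness of g
(`TameOfOrder.of_comp`). The gauge is P = ∏ log log(1/|z_i|). It is at least 1 because r_i ≤ e^{-e},
and its pull-back dominates ∏ log Im x_i.

Tameness is compared with multi-index bounds by the Leibniz rule (`exists_weighted_deriv_succ`),
provided that each weight is multiplied by a constant under the weighted operators. The weights Im
x_i have this property, so imaginary logarithmic growth implies tameness. Downstairs z_i has it but
z_i log(1/|z_i|) does not. Since 1/log(1/|z_i|) is tame, the weights may be changed to z_i, and the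
log-log bounds follow (`Tame.mem_logLogFunctions`).

For forms, the coefficients on the cover need not descend. Instead the form downstairs is evaluated
on a rescaled real frame, and these values pull back to constant combinations of the coefficients on
the cover (`isGeneratedBy_of_hasImLogGrowthOn`). Finally, the forms with tame coefficients in the
frame c_a⁻¹ dz_i, c_a⁻¹ dz̄_i are stable under ∂ and ∂̄ (`IsGeneratedBy.dolbeault`): c_a ∂_a c_b is
a constant multiple of c_b for a ≠ b, and a = b only meets a repeated covector. So the growth of ∂ω,
∂̄ω and ∂∂̄ω comes for free. -/

/-- The covectors `dz_i` (index `(i, false)`) and `dz̄_i` (index `(i, true)`). -/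
def covector (a : Fin d × Bool) : Cn d →L[ℝ] ℂ := if a.2 then dzbar a.1 else dz a.1

/-- The coefficient of a covector at `dz_i` or `dz̄_i`. -/
def wirtCoeff (a : Fin d × Bool) (L : Cn d →L[ℝ] ℂ) : ℂ :=
  (L (Pi.single a.1 1) + (if a.2 then Complex.I else -Complex.I) * L (Pi.single a.1 Complex.I)) / 2

/-- The Wirtinger derivatives, `∂/∂z_i` for `(i, false)` and `∂/∂z̄_i` for `(i, true)`. -/
def wirt (a : Fin d × Bool) (f : Cn d → ℂ) (z : Cn d) : ℂ := wirtCoeff a (fderiv ℝ f z)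

theorem wirt_false (i : Fin d) : wirt (i, false) = wirtZ i := by
  ext f z
  simp [wirt, wirtCoeff, wirtZ, sub_eq_add_neg]

theorem wirt_true (i : Fin d) : wirt (i, true) = wirtZbar i := by
  ext f z
  simp [wirt, wirtCoeff, wirtZbar]

@[simp] theorem wirtCoeff_add (a : Fin d × Bool) (L L' : Cn d →L[ℝ] ℂ) :
    wirtCoeff a (L + L') = wirtCoeff a L + wirtCoeff a L' := by
  rw [wirtCoeff, wirtCoeff, wirtCoeff, add_apply, add_apply]; ring

@[simp] theorem wirtCoeff_smul (a : Fin d × Bool) (c : ℂ) (L : Cn d →L[ℝ] ℂ) :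
    wirtCoeff a (c • L) = c * wirtCoeff a L := by
  rw [wirtCoeff, wirtCoeff, smul_apply, smul_apply, smul_eq_mul, smul_eq_mul]; ring

@[simp] theorem wirtCoeff_zero (a : Fin d × Bool) : wirtCoeff a (0 : Cn d →L[ℝ] ℂ) = 0 := by
  simp [wirtCoeff]

theorem dz_apply (i : Fin d) (v : Cn d) : dz i v = v i := rfl

theorem dzbar_apply (i : Fin d) (v : Cn d) : dzbar i v = (starRingEnd ℂ) (v i) := rfl

theorem wirtCoeff_covector (a b : Fin d × Bool) :
    wirtCoeff a (covector b) = if a = b then 1 else 0 := by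
  obtain ⟨i, s⟩ := a
  obtain ⟨j, t⟩ := b
  by_cases h : i = j
  · subst h
    cases s <;> cases t <;> simp [wirtCoeff, covector, dz_apply, dzbar_apply]
  · have h' : j ≠ i := Ne.symm h
    cases s <;> cases t <;> simp [wirtCoeff, covector, dz_apply, dzbar_apply, h, h']

/-- A real linear map to ℂ is determined on the real basis e_i, √-1 e_i, and its complex linear and
antilinear parts are read off from these values. -/
theorem eq_sum_wirtCoeff (L : Cn d →L[ℝ] ℂ) :
    L = ∑ a, wirtCoeff a L • covector a := by
  ext v
  have hv : v = ∑ i, ((v i).re • (Pi.single i 1 : Cn d) + (v i).im • (Pi.single i Complex.I : Cn d)) := by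
    ext j
    simp [Finset.sum_apply, Pi.single_apply, Finset.sum_add_distrib]
  conv_lhs => rw [hv]
  simp only [map_sum, map_add, map_smul, sum_apply, add_apply, smul_apply, Fintype.sum_prod_type, Fintype.sum_bool]
  refine Finset.sum_congr rfl fun i _ => ?_
  simp only [wirtCoeff, covector, dz_apply, dzbar_apply, if_true, smul_eq_mul, Bool.false_eq_true,
    if_false, Complex.real_smul]
  have e1 : (starRingEnd ℂ) (v i) = (v i).re - (v i).im * Complex.I := by
    apply Complex.ext <;> simp
  conv_rhs => rw [e1, ← Complex.re_add_im (v i)]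
  simp only [Complex.add_re, Complex.add_im, Complex.ofReal_re, Complex.ofReal_im, Complex.mul_re,
    Complex.mul_im, Complex.I_re, Complex.I_im, mul_zero, mul_one, sub_zero, add_zero, zero_add]
  ring_nf
  simp only [Complex.I_sq]
  ring

theorem wirt_of_hasFDerivAt {a : Fin d × Bool} {f : Cn d → ℂ} {z : Cn d} {L : Cn d →L[ℝ] ℂ}
    (h : HasFDerivAt f L z) : wirt a f z = wirtCoeff a L := by
  rw [wirt, h.fderiv]

theorem wirt_add {a : Fin d × Bool} {f g : Cn d → ℂ} {z : Cn d}
    (hf : DifferentiableAt ℝ f z) (hg : DifferentiableAt ℝ g z) :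
    wirt a (fun z => f z + g z) z = wirt a f z + wirt a g z := by
  rw [wirt_of_hasFDerivAt (hf.hasFDerivAt.fun_add hg.hasFDerivAt)]
  simp [wirt]

theorem wirt_mul {a : Fin d × Bool} {f g : Cn d → ℂ} {z : Cn d}
    (hf : DifferentiableAt ℝ f z) (hg : DifferentiableAt ℝ g z) :
    wirt a (fun z => f z * g z) z = f z * wirt a g z + wirt a f z * g z := by
  rw [wirt_of_hasFDerivAt (hf.hasFDerivAt.fun_mul hg.hasFDerivAt)]
  simp [wirt, mul_comm]

@[simp] theorem wirt_const (a : Fin d × Bool) (c : ℂ) (z : Cn d) : wirt a (fun _ => c) z = 0 := by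
  rw [wirt_of_hasFDerivAt (hasFDerivAt_const c z), wirtCoeff_zero]

theorem wirt_congr {S : Set (Cn d)} (hS : IsOpen S) (a : Fin d × Bool) {f g : Cn d → ℂ}
    (h : Set.EqOn f g S) : Set.EqOn (wirt a f) (wirt a g) S := by
  intro z hz
  have : f =ᶠ[nhds z] g := Filter.eventuallyEq_of_mem (hS.mem_nhds hz) h
  rw [wirt, wirt, this.fderiv_eq]

theorem differentiableAt_of_contDiffOn {E F : Type*} [NormedAddCommGroup E] [NormedSpace ℝ E]
    [NormedAddCommGroup F] [NormedSpace ℝ F] {S : Set E} (hS : IsOpen S)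
    {f : E → F} (hf : ContDiffOn ℝ ∞ f S) {z : E} (hz : z ∈ S) : DifferentiableAt ℝ f z :=
  (hf.contDiffAt (hS.mem_nhds hz)).differentiableAt (by simp)

theorem contDiffOn_wirt {S : Set (Cn d)} (hS : IsOpen S) (a : Fin d × Bool) {f : Cn d → ℂ}
    (hf : ContDiffOn ℝ ∞ f S) : ContDiffOn ℝ ∞ (wirt a f) S := by
  have h : ContDiffOn ℝ ∞ (fderiv ℝ f) S := hf.fderiv_of_isOpen hS (by simp)
  have e : ∀ v, ContDiffOn ℝ ∞ (fun z => fderiv ℝ f z v) S := fun v =>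
    h.clm_apply contDiffOn_const
  unfold wirt wirtCoeff
  exact ((e _).add (contDiffOn_const.mul (e _))).div_const _

/-- Symmetry of the second real derivative. It needs smoothness near the point, so all reorderings
of derivatives hold only on the open set S. -/
theorem wirt_comm {S : Set (Cn d)} (hS : IsOpen S) (a b : Fin d × Bool) {f : Cn d → ℂ}
    (hf : ContDiffOn ℝ ∞ f S) : Set.EqOn (wirt a (wirt b f)) (wirt b (wirt a f)) S := by
  intro z hz
  have h : ContDiffOn ℝ ∞ (fderiv ℝ f) S := hf.fderiv_of_isOpen hS (by simp)
  have hd : HasFDerivAt (fderiv ℝ f) (fderiv ℝ (fderiv ℝ f) z) z :=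
    (differentiableAt_of_contDiffOn hS h hz).hasFDerivAt
  have hsymm : ∀ v w, fderiv ℝ (fderiv ℝ f) z v w = fderiv ℝ (fderiv ℝ f) z w v :=
    (hf.contDiffAt (hS.mem_nhds hz)).isSymmSndFDerivAt (by
      rw [minSmoothness_of_isRCLikeNormedField]; exact WithTop.coe_le_coe.2 (le_top : (2 : ℕ∞) ≤ ⊤))
  have hev : ∀ v, HasFDerivAt (fun z => fderiv ℝ f z v)
      ((fderiv ℝ (fderiv ℝ f) z).flip v) z := fun v => by
    have := hd.clm_apply (hasFDerivAt_const v z)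
    simpa using this
  have key : ∀ a b : Fin d × Bool, wirt a (wirt b f) z =
      wirtCoeff a ((1 / 2 : ℂ) • ((fderiv ℝ (fderiv ℝ f) z).flip (Pi.single b.1 1) +
        (if b.2 then Complex.I else -Complex.I) •
          (fderiv ℝ (fderiv ℝ f) z).flip (Pi.single b.1 Complex.I))) := by
    intro a b
    refine wirt_of_hasFDerivAt ?_
    have := ((hev (Pi.single b.1 1)).add ((hev (Pi.single b.1 Complex.I)).const_mul
      (if b.2 then Complex.I else -Complex.I))).const_mul (1 / 2 : ℂ)
    refine this.congr_of_eventuallyEq (Filter.Eventually.of_forall fun w => ?_)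
    simp only [wirt, wirtCoeff, Pi.add_apply]
    ring
  rw [key, key]
  simp only [wirtCoeff, smul_apply, add_apply,
    ContinuousLinearMap.flip_apply, smul_eq_mul]
  rw [hsymm (Pi.single b.1 1) (Pi.single a.1 1), hsymm (Pi.single b.1 1) (Pi.single a.1 Complex.I),
    hsymm (Pi.single b.1 Complex.I) (Pi.single a.1 1),
    hsymm (Pi.single b.1 Complex.I) (Pi.single a.1 Complex.I)]
  ring

/-! ### Reordering iterated Wirtinger derivatives -/

/-- The iterated Wirtinger derivative with exponents `γ`. -/
def iterWirt (γ : Fin d × Bool → ℕ) (f : Cn d → ℂ) : Cn d → ℂ :=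
  mixedDeriv (fun i => γ (i, false)) (fun i => γ (i, true)) f

theorem iterate_wirt_congr {S : Set (Cn d)} (hS : IsOpen S) (a : Fin d × Bool) (m : ℕ)
    {f g : Cn d → ℂ} (h : Set.EqOn f g S) : Set.EqOn ((wirt a)^[m] f) ((wirt a)^[m] g) S := by
  induction m generalizing f g with
  | zero => exact h
  | succ m ih => exact ih (wirt_congr hS a h)

theorem contDiffOn_iterate_wirt {S : Set (Cn d)} (hS : IsOpen S) (a : Fin d × Bool) (m : ℕ)
    {f : Cn d → ℂ} (hf : ContDiffOn ℝ ∞ f S) : ContDiffOn ℝ ∞ ((wirt a)^[m] f) S := by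
  induction m generalizing f with
  | zero => exact hf
  | succ m ih => exact ih (contDiffOn_wirt hS a hf)

theorem wirt_iterate_comm {S : Set (Cn d)} (hS : IsOpen S) (a b : Fin d × Bool) (m : ℕ)
    {f : Cn d → ℂ} (hf : ContDiffOn ℝ ∞ f S) :
    Set.EqOn (wirt a ((wirt b)^[m] f)) ((wirt b)^[m] (wirt a f)) S := by
  induction m generalizing f with
  | zero => exact fun _ _ => rfl
  | succ m ih =>
    exact (ih (contDiffOn_wirt hS b hf)).trans (iterate_wirt_congr hS b m (wirt_comm hS a b hf))

/-- The Wirtinger derivatives with indices in a list, with exponents `γ`. -/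
def foldWirt (l : List (Fin d × Bool)) (γ : Fin d × Bool → ℕ) (f : Cn d → ℂ) : Cn d → ℂ :=
  l.foldr (fun a g => (wirt a)^[γ a] g) f

theorem contDiffOn_foldWirt {S : Set (Cn d)} (hS : IsOpen S) (l : List (Fin d × Bool))
    (γ : Fin d × Bool → ℕ) {f : Cn d → ℂ} (hf : ContDiffOn ℝ ∞ f S) :
    ContDiffOn ℝ ∞ (foldWirt l γ f) S := by
  induction l with
  | nil => exact hf
  | cons a l ih => exact contDiffOn_iterate_wirt hS a _ ih

/-- `mixedDeriv` fixes an order of differentiation. One more derivative commutes past the other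
blocks until it joins its own; `Nodup` ensures that there is only one such block. -/
theorem wirt_foldWirt {S : Set (Cn d)} (hS : IsOpen S) (l : List (Fin d × Bool)) (hl : l.Nodup)
    (γ : Fin d × Bool → ℕ) {f : Cn d → ℂ} (hf : ContDiffOn ℝ ∞ f S) (a : Fin d × Bool)
    (ha : a ∈ l) :
    Set.EqOn (wirt a (foldWirt l γ f)) (foldWirt l (γ + Pi.single a 1) f) S := by
  induction l with
  | nil => simp at ha
  | cons b l ih =>
    rw [List.nodup_cons] at hl
    by_cases hab : a = b
    · subst hab
      have : foldWirt l (γ + Pi.single a 1) f = foldWirt l γ f := by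
        refine List.foldr_ext _ _ _ fun c hc g => ?_
        have hca : c ≠ a := fun h => hl.1 (h ▸ hc)
        simp [hca]
      intro z _
      have e : foldWirt (a :: l) (γ + Pi.single a 1) f
          = (wirt a)^[γ a + 1] (foldWirt l (γ + Pi.single a 1) f) := by
        simp [foldWirt]
      rw [e, this, Function.iterate_succ_apply']
      rfl
    · have hal : a ∈ l := by simpa [hab] using ha
      have e : foldWirt (b :: l) (γ + Pi.single a 1) f
          = (wirt b)^[γ b] (foldWirt l (γ + Pi.single a 1) f) := by
        simp [foldWirt, Ne.symm hab]
      rw [e]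
      exact (wirt_iterate_comm hS a b _ (contDiffOn_foldWirt hS l γ hf)).trans
        (iterate_wirt_congr hS b _ (ih hl.2 hal))

/-- The list of all indices, in the order of the definition of `mixedDeriv`. -/
def indexList (d : ℕ) : List (Fin d × Bool) :=
  (List.finRange d).map (fun i => (i, false)) ++ (List.finRange d).map (fun i => (i, true))

theorem iterWirt_eq (γ : Fin d × Bool → ℕ) (f : Cn d → ℂ) :
    iterWirt γ f = foldWirt (indexList d) γ f := by
  simp only [iterWirt, mixedDeriv, foldWirt, indexList, List.foldr_append, List.foldr_map,
    wirt_false, wirt_true]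

theorem nodup_indexList : (indexList d).Nodup := by
  refine List.Nodup.append ?_ ?_ ?_
  · exact (List.nodup_finRange d).map fun i j h => by simpa using h
  · exact (List.nodup_finRange d).map fun i j h => by simpa using h
  · intro x h1 h2
    simp only [List.mem_map] at h1 h2
    obtain ⟨i, _, rfl⟩ := h1
    obtain ⟨j, _, h⟩ := h2
    simp at h

theorem mem_indexList (a : Fin d × Bool) : a ∈ indexList d := by
  obtain ⟨i, _ | _⟩ := a <;> simp [indexList]

theorem contDiffOn_iterWirt {S : Set (Cn d)} (hS : IsOpen S) (γ : Fin d × Bool → ℕ)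
    {f : Cn d → ℂ} (hf : ContDiffOn ℝ ∞ f S) : ContDiffOn ℝ ∞ (iterWirt γ f) S := by
  rw [iterWirt_eq]
  exact contDiffOn_foldWirt hS _ γ hf

theorem wirt_iterWirt {S : Set (Cn d)} (hS : IsOpen S) (γ : Fin d × Bool → ℕ) {f : Cn d → ℂ}
    (hf : ContDiffOn ℝ ∞ f S) (a : Fin d × Bool) :
    Set.EqOn (wirt a (iterWirt γ f)) (iterWirt (γ + Pi.single a 1) f) S := by
  rw [iterWirt_eq, iterWirt_eq]
  exact wirt_foldWirt hS _ nodup_indexList γ hf a (mem_indexList a)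

theorem iterWirt_zero (f : Cn d → ℂ) : iterWirt 0 f = f := by
  rw [iterWirt_eq]
  unfold foldWirt
  induction indexList d with
  | nil => rfl
  | cons a l ih => simp

end Wirtinger

/-! ### Functions of moderate growth under weighted Wirtinger derivatives -/

section Tame

variable {d : ℕ}

/-- `f` is bounded on `S` by a multiple of a power of `P`. -/
def BoundedByPower (S : Set (Cn d)) (P : Cn d → ℝ) (f : Cn d → ℂ) : Prop :=
  ∃ (N : ℕ) (C : ℝ), ∀ z ∈ S, ‖f z‖ ≤ C * P z ^ N

/-- `f` is smooth on `S`, and it and its images under words of length at most `n` in the operators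
`c a • wirt a` are bounded by powers of `P`. -/
def TameOfOrder (S : Set (Cn d)) (P : Cn d → ℝ) (c : Fin d × Bool → Cn d → ℂ) :
    ℕ → (Cn d → ℂ) → Prop
  | 0, f => ContDiffOn ℝ ∞ f S ∧ BoundedByPower S P f
  | n + 1, f => (ContDiffOn ℝ ∞ f S ∧ BoundedByPower S P f) ∧
      ∀ a, TameOfOrder S P c n (fun z => c a z * wirt a f z)

/-- `TameOfOrder` for every order. -/
def Tame (S : Set (Cn d)) (P : Cn d → ℝ) (c : Fin d × Bool → Cn d → ℂ) (f : Cn d → ℂ) : Prop :=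
  ∀ n, TameOfOrder S P c n f

/-- `v` is an eigenfunction of `c • wirt a` on `S`. -/
def IsWeight (S : Set (Cn d)) (c : Cn d → ℂ) (a : Fin d × Bool) (v : Cn d → ℂ) : Prop :=
  ∃ κ : ℂ, ∀ z ∈ S, c z * wirt a v z = κ * v z

variable {S : Set (Cn d)} {P : Cn d → ℝ} {c : Fin d × Bool → Cn d → ℂ} {f g : Cn d → ℂ} {n : ℕ}

theorem BoundedByPower.congr (h : BoundedByPower S P f) (e : Set.EqOn f g S) :
    BoundedByPower S P g := by
  obtain ⟨N, C, h⟩ := h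
  exact ⟨N, C, fun z hz => e hz ▸ h z hz⟩

/-- Since P ≥ 1, exponents may be raised at will, so that several bounds can share one exponent. -/
theorem BoundedByPower.exists_pos (hP : ∀ z ∈ S, 1 ≤ P z) (h : BoundedByPower S P f) :
    ∃ N : ℕ, ∀ N' ≥ N, ∃ C : ℝ, 0 < C ∧ ∀ z ∈ S, ‖f z‖ ≤ C * P z ^ N' := by
  obtain ⟨N, C, h⟩ := h
  refine ⟨N, fun N' hN => ⟨max C 1, by positivity, fun z hz => (h z hz).trans ?_⟩⟩
  have := hP z hz
  gcongr
  exact le_max_left _ _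

theorem BoundedByPower.add (hP : ∀ z ∈ S, 1 ≤ P z) (hf : BoundedByPower S P f)
    (hg : BoundedByPower S P g) : BoundedByPower S P (fun z => f z + g z) := by
  obtain ⟨N, hN⟩ := hf.exists_pos hP
  obtain ⟨M, hM⟩ := hg.exists_pos hP
  obtain ⟨C, _, hC⟩ := hN (max N M) (le_max_left _ _)
  obtain ⟨C', _, hC'⟩ := hM (max N M) (le_max_right _ _)
  refine ⟨max N M, C + C', fun z hz => (norm_add_le _ _).trans ?_⟩
  rw [add_mul]
  exact add_le_add (hC z hz) (hC' z hz)

theorem BoundedByPower.mul (hP : ∀ z ∈ S, 1 ≤ P z) (hf : BoundedByPower S P f)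
    (hg : BoundedByPower S P g) : BoundedByPower S P (fun z => f z * g z) := by
  obtain ⟨N, hN⟩ := hf.exists_pos hP
  obtain ⟨M, hM⟩ := hg.exists_pos hP
  obtain ⟨C, hC0, hC⟩ := hN N le_rfl
  obtain ⟨C', hC0', hC'⟩ := hM M le_rfl
  refine ⟨N + M, C * C', fun z hz => ?_⟩
  have := hP z hz
  calc ‖f z * g z‖ ≤ (C * P z ^ N) * (C' * P z ^ M) := by
        rw [norm_mul]
        exact mul_le_mul (hC z hz) (hC' z hz) (norm_nonneg _) (by positivity)
    _ = _ := by ring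

theorem boundedByPower_of_norm_le (C : ℝ) (h : ∀ z ∈ S, ‖f z‖ ≤ C) : BoundedByPower S P f :=
  ⟨0, C, fun z hz => by simpa using h z hz⟩

theorem TameOfOrder.base (h : TameOfOrder S P c n f) :
    ContDiffOn ℝ ∞ f S ∧ BoundedByPower S P f := by
  cases n with
  | zero => exact h
  | succ n => exact h.1

theorem TameOfOrder.congr (hS : IsOpen S) (h : TameOfOrder S P c n f) (e : Set.EqOn f g S) :
    TameOfOrder S P c n g := by
  have hb : ContDiffOn ℝ ∞ g S ∧ BoundedByPower S P g :=
    ⟨h.base.1.congr fun z hz => (e hz).symm, h.base.2.congr e⟩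
  induction n generalizing f g with
  | zero => exact hb
  | succ n ih =>
    have e' : ∀ a, Set.EqOn (fun z => c a z * wirt a f z) (fun z => c a z * wirt a g z) S :=
      fun a z hz => by simp only [wirt_congr hS a e hz]
    exact ⟨hb, fun a => ih (h.2 a) (e' a)
      ⟨(h.2 a).base.1.congr fun z hz => (e' a hz).symm, (h.2 a).base.2.congr (e' a)⟩⟩

theorem TameOfOrder.of_succ (h : TameOfOrder S P c (n + 1) f) : TameOfOrder S P c n f := by
  induction n generalizing f with
  | zero => exact h.1
  | succ n ih => exact ⟨h.1, fun a => ih (h.2 a)⟩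

theorem TameOfOrder.add (hS : IsOpen S) (hP : ∀ z ∈ S, 1 ≤ P z) (hf : TameOfOrder S P c n f)
    (hg : TameOfOrder S P c n g) : TameOfOrder S P c n (fun z => f z + g z) := by
  have hb : ∀ {f g : Cn d → ℂ}, ContDiffOn ℝ ∞ f S ∧ BoundedByPower S P f →
      ContDiffOn ℝ ∞ g S ∧ BoundedByPower S P g →
      ContDiffOn ℝ ∞ (fun z => f z + g z) S ∧ BoundedByPower S P (fun z => f z + g z) :=
    fun hf hg => ⟨hf.1.add hg.1, hf.2.add hP hg.2⟩
  induction n generalizing f g with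
  | zero => exact hb hf hg
  | succ n ih =>
    refine ⟨hb hf.1 hg.1, fun a => (ih (hf.2 a) (hg.2 a)).congr hS fun z hz => ?_⟩
    rw [wirt_add (differentiableAt_of_contDiffOn hS hf.1.1 hz)
      (differentiableAt_of_contDiffOn hS hg.1.1 hz), mul_add]

theorem TameOfOrder.mul (hS : IsOpen S) (hP : ∀ z ∈ S, 1 ≤ P z) (hf : TameOfOrder S P c n f)
    (hg : TameOfOrder S P c n g) : TameOfOrder S P c n (fun z => f z * g z) := by
  have hb : ∀ {f g : Cn d → ℂ}, ContDiffOn ℝ ∞ f S ∧ BoundedByPower S P f →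
      ContDiffOn ℝ ∞ g S ∧ BoundedByPower S P g →
      ContDiffOn ℝ ∞ (fun z => f z * g z) S ∧ BoundedByPower S P (fun z => f z * g z) :=
    fun hf hg => ⟨hf.1.mul hg.1, hf.2.mul hP hg.2⟩
  induction n generalizing f g with
  | zero => exact hb hf hg
  | succ n ih =>
    -- The product rule differentiates one factor and leaves the other, which is then used at the
    -- lower order through `of_succ`.
    refine ⟨hb hf.1 hg.1, fun a =>
      (TameOfOrder.add hS hP (ih hf.of_succ (hg.2 a)) (ih (hf.2 a) hg.of_succ)).congr hS
        fun z hz => ?_⟩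
    rw [wirt_mul (differentiableAt_of_contDiffOn hS hf.1.1 hz)
      (differentiableAt_of_contDiffOn hS hg.1.1 hz)]
    ring

theorem tameOfOrder_const (hS : IsOpen S) (x : ℂ) : TameOfOrder S P c n (fun _ => x) := by
  have hb : ∀ x : ℂ, ContDiffOn ℝ ∞ (fun _ => x) S ∧ BoundedByPower S P (fun _ => x) :=
    fun x => ⟨contDiffOn_const, boundedByPower_of_norm_le ‖x‖ fun _ _ => le_rfl⟩
  induction n generalizing x with
  | zero => exact hb x
  | succ n ih => exact ⟨hb x, fun a => (ih 0).congr hS fun z _ => by simp⟩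

theorem Tame.contDiffOn (h : Tame S P c f) : ContDiffOn ℝ ∞ f S := (h 0).base.1

theorem Tame.boundedByPower (h : Tame S P c f) : BoundedByPower S P f := (h 0).base.2

theorem Tame.congr (hS : IsOpen S) (h : Tame S P c f) (e : Set.EqOn f g S) : Tame S P c g :=
  fun n => (h n).congr hS e

theorem Tame.add (hS : IsOpen S) (hP : ∀ z ∈ S, 1 ≤ P z) (hf : Tame S P c f)
    (hg : Tame S P c g) : Tame S P c (fun z => f z + g z) :=
  fun n => (hf n).add hS hP (hg n)

theorem Tame.mul (hS : IsOpen S) (hP : ∀ z ∈ S, 1 ≤ P z) (hf : Tame S P c f)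
    (hg : Tame S P c g) : Tame S P c (fun z => f z * g z) :=
  fun n => (hf n).mul hS hP (hg n)

theorem tame_const (hS : IsOpen S) (x : ℂ) : Tame S P c (fun _ => x) :=
  fun _ => tameOfOrder_const hS x

theorem Tame.wirt (h : Tame S P c f) (a : Fin d × Bool) :
    Tame S P c (fun z => c a z * wirt a f z) :=
  fun n => (h (n + 1)).2 a

theorem Tame.sum {ι : Type*} (hS : IsOpen S) (hP : ∀ z ∈ S, 1 ≤ P z) (s : Finset ι)
    {F : ι → Cn d → ℂ} (h : ∀ i ∈ s, Tame S P c (F i)) : Tame S P c (fun z => ∑ i ∈ s, F i z) := by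
  classical
  induction s using Finset.induction_on with
  | empty => simpa using tame_const hS 0
  | insert i s hi ih =>
    simp only [Finset.sum_insert hi]
    exact (h i (Finset.mem_insert_self _ _)).add hS hP
      (ih fun j hj => h j (Finset.mem_insert_of_mem hj))

/-! #### Weights -/

theorem isWeight_const (c : Cn d → ℂ) (a : Fin d × Bool) (x : ℂ) :
    IsWeight S c a (fun _ => x) := ⟨0, fun z _ => by simp⟩

theorem IsWeight.mul {c : Cn d → ℂ} {a : Fin d × Bool} (hS : IsOpen S)
    (hf : ContDiffOn ℝ ∞ f S) (hg : ContDiffOn ℝ ∞ g S) (wf : IsWeight S c a f)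
    (wg : IsWeight S c a g) : IsWeight S c a (fun z => f z * g z) := by
  obtain ⟨κ, hκ⟩ := wf
  obtain ⟨μ, hμ⟩ := wg
  refine ⟨κ + μ, fun z hz => ?_⟩
  rw [wirt_mul (differentiableAt_of_contDiffOn hS hf hz) (differentiableAt_of_contDiffOn hS hg hz)]
  linear_combination f z * hμ z hz + g z * hκ z hz

theorem IsWeight.inv {c : Cn d → ℂ} {a : Fin d × Bool} (hS : IsOpen S)
    (hf : ContDiffOn ℝ ∞ f S) (h0 : ∀ z ∈ S, f z ≠ 0) (wf : IsWeight S c a f) :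
    IsWeight S c a (fun z => (f z)⁻¹) := by
  obtain ⟨κ, hκ⟩ := wf
  refine ⟨-κ, fun z hz => ?_⟩
  have h1 : Set.EqOn (fun z => f z * (f z)⁻¹) (fun _ => 1) S := fun z hz =>
    mul_inv_cancel₀ (h0 z hz)
  have h2 := wirt_congr hS a h1 hz
  rw [wirt_const, wirt_mul (g := fun z => (f z)⁻¹) (differentiableAt_of_contDiffOn hS hf hz)
    (differentiableAt_of_contDiffOn hS (hf.inv h0) hz)] at h2
  have h3 := hκ z hz
  have h4 := h0 z hz
  have h5 : f z * (c z * LogLog.wirt a (fun z => (f z)⁻¹) z) = -κ := by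
    have : c z * LogLog.wirt a f z * (f z)⁻¹ = κ := by rw [h3, mul_assoc, mul_inv_cancel₀ h4, mul_one]
    linear_combination c z * h2 - this
  rw [← h5]
  field_simp

theorem IsWeight.pow {c : Cn d → ℂ} {a : Fin d × Bool} (hS : IsOpen S)
    (hf : ContDiffOn ℝ ∞ f S) (wf : IsWeight S c a f) (m : ℕ) :
    IsWeight S c a (fun z => f z ^ m) := by
  induction m with
  | zero => simpa using isWeight_const c a 1
  | succ m ih =>
    simp only [pow_succ]
    exact ih.mul hS (hf.pow m) hf wf

theorem IsWeight.prod {ι : Type*} {c : Cn d → ℂ} {a : Fin d × Bool} (hS : IsOpen S)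
    {F : ι → Cn d → ℂ} (s : Finset ι) (hF : ∀ i ∈ s, ContDiffOn ℝ ∞ (F i) S)
    (wF : ∀ i ∈ s, IsWeight S c a (F i)) : IsWeight S c a (fun z => ∏ i ∈ s, F i z) := by
  classical
  induction s using Finset.induction_on with
  | empty => simpa using isWeight_const c a 1
  | insert i s hi ih =>
    simp only [Finset.prod_insert hi]
    have hs : ∀ j ∈ s, j ∈ insert i s := fun j hj => Finset.mem_insert_of_mem hj
    exact (wF i (Finset.mem_insert_self _ _)).mul hS (hF i (Finset.mem_insert_self _ _))
      (contDiffOn_prod fun j hj => hF j (hs j hj))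
      (ih (fun j hj => hF j (hs j hj)) fun j hj => wF j (hs j hj))

/-- Every word in the operators multiplies an eigenfunction by a scalar, so the bound on f itself
suffices. -/
theorem tame_of_isWeight (hS : IsOpen S) (hP : ∀ z ∈ S, 1 ≤ P z) (hf : ContDiffOn ℝ ∞ f S)
    (hb : BoundedByPower S P f) (wf : ∀ a, IsWeight S (c a) a f) : Tame S P c f := by
  intro n
  induction n with
  | zero => exact ⟨hf, hb⟩
  | succ n ih =>
    refine ⟨⟨hf, hb⟩, fun a => ?_⟩
    obtain ⟨κ, hκ⟩ := wf a
    exact ((tameOfOrder_const hS κ).mul hS hP ih).congr hS fun z hz => (hκ z hz).symm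

/-! ### Words in weighted operators versus multi-index derivatives -/

/-- The monomial with exponents `γ` in the functions `v`. -/
def monom (v : Fin d × Bool → Cn d → ℂ) (γ : Fin d × Bool → ℕ) (z : Cn d) : ℂ :=
  ∏ a, v a z ^ γ a

variable {v : Fin d × Bool → Cn d → ℂ}

theorem contDiffOn_monom (hv : ∀ a, ContDiffOn ℝ ∞ (v a) S) (γ : Fin d × Bool → ℕ) :
    ContDiffOn ℝ ∞ (monom v γ) S :=
  contDiffOn_prod fun a _ => (hv a).pow _

theorem monom_add_single (γ : Fin d × Bool → ℕ) (a : Fin d × Bool) (z : Cn d) :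
    monom v (γ + Pi.single a 1) z = v a z * monom v γ z := by
  simp only [monom, Pi.add_apply, pow_add, Finset.prod_mul_distrib, mul_comm (v a z)]
  congr 1
  rw [Finset.prod_eq_single a] <;> simp +contextual

/-- The weighted derivative `v^γ ∂^γ f` of order `γ + e_a` in terms of those of order `γ`. -/
theorem exists_weighted_deriv_succ (hS : IsOpen S) (hv : ∀ a, ContDiffOn ℝ ∞ (v a) S)
    (wv : ∀ a b, IsWeight S (v a) a (v b)) (hf : ContDiffOn ℝ ∞ f S) (γ : Fin d × Bool → ℕ)
    (a : Fin d × Bool) : ∃ κ : ℂ, ∀ z ∈ S,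
      v a z * wirt a (fun z => monom v γ z * iterWirt γ f z) z =
        κ * (monom v γ z * iterWirt γ f z) +
          monom v (γ + Pi.single a 1) z * iterWirt (γ + Pi.single a 1) f z := by
  obtain ⟨κ, hκ⟩ : IsWeight S (v a) a (monom v γ) :=
    IsWeight.prod hS _ (fun b _ => (hv b).pow _) fun b _ => (wv a b).pow hS (hv b) _
  refine ⟨κ, fun z hz => ?_⟩
  rw [wirt_mul (differentiableAt_of_contDiffOn hS (contDiffOn_monom hv γ) hz)
    (differentiableAt_of_contDiffOn hS (contDiffOn_iterWirt hS γ hf) hz),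
    wirt_iterWirt hS γ hf a hz, monom_add_single]
  linear_combination iterWirt γ f z * hκ z hz

/-- By `exists_weighted_deriv_succ` the span of the functions v^γ ∂^γ f is stable under the
operators v_a ∂_a. The induction on the order treats all γ at once, and f is the case γ = 0. -/
theorem tame_of_weighted_deriv (hS : IsOpen S) (hP : ∀ z ∈ S, 1 ≤ P z)
    (hv : ∀ a, ContDiffOn ℝ ∞ (v a) S) (wv : ∀ a b, IsWeight S (v a) a (v b))
    (hf : ContDiffOn ℝ ∞ f S)
    (hb : ∀ γ, BoundedByPower S P (fun z => monom v γ z * iterWirt γ f z)) : Tame S P v f := by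
  have key : ∀ n γ, TameOfOrder S P v n (fun z => monom v γ z * iterWirt γ f z) := by
    intro n
    have hbase : ∀ γ, TameOfOrder S P v 0 (fun z => monom v γ z * iterWirt γ f z) := fun γ =>
      ⟨(contDiffOn_monom hv γ).mul (contDiffOn_iterWirt hS γ hf), hb γ⟩
    induction n with
    | zero => exact hbase
    | succ n ih =>
      refine fun γ => ⟨hbase γ, fun a => ?_⟩
      obtain ⟨κ, hκ⟩ := exists_weighted_deriv_succ hS hv wv hf γ a
      exact (((tameOfOrder_const hS κ).mul hS hP (ih γ)).add hS hP
        (ih (γ + Pi.single a 1))).congr hS fun z hz => (hκ z hz).symm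
  exact fun n => (key n 0).congr hS fun z _ => by simp [monom, iterWirt_zero]

/-- The passage back to multi-indices, with a change of weights: `exists_weighted_deriv_succ` is
solved for its top term, and v_a ∂_a = u_a (c_a ∂_a) preserves tameness. Only v has to consist of
eigenfunctions, not c. -/
theorem tame_weighted_deriv (hS : IsOpen S) (hP : ∀ z ∈ S, 1 ≤ P z)
    (hv : ∀ a, ContDiffOn ℝ ∞ (v a) S) (wv : ∀ a b, IsWeight S (v a) a (v b))
    {u : Fin d × Bool → Cn d → ℂ} (hu : ∀ a, Tame S P c (u a))
    (huv : ∀ a, ∀ z ∈ S, v a z = u a z * c a z) (hf : Tame S P c f) (γ : Fin d × Bool → ℕ) :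
    Tame S P c (fun z => monom v γ z * iterWirt γ f z) := by
  induction hm : ∑ a, γ a generalizing γ with
  | zero =>
    have : γ = 0 := by
      ext a
      simpa using (Finset.sum_eq_zero_iff.1 hm) a (Finset.mem_univ a)
    subst this
    exact hf.congr hS fun z _ => by simp [monom, iterWirt_zero]
  | succ m ih =>
    obtain ⟨a, ha⟩ : ∃ a, 0 < γ a := by
      by_contra! h
      simp [fun a => Nat.le_zero.1 (h a)] at hm
    obtain ⟨δ, rfl⟩ : ∃ δ : Fin d × Bool → ℕ, γ = δ + Pi.single a 1 := by
      refine ⟨γ - Pi.single a 1, (tsub_add_cancel_of_le ?_).symm⟩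
      intro b
      by_cases hb : b = a
      · subst hb; rw [Pi.single_eq_same]; exact ha
      · simp [hb]
    have hδ : ∑ b, δ b = m := by
      simp only [Pi.add_apply, Finset.sum_add_distrib, Finset.sum_pi_single', Finset.mem_univ,
        if_true] at hm
      simpa [Finset.sum_pi_single'] using hm
    obtain ⟨κ, hκ⟩ := exists_weighted_deriv_succ hS hv wv hf.contDiffOn δ a
    refine (((hu a).mul hS hP ((ih δ hδ).wirt a)).add hS hP
      ((tame_const hS (-κ)).mul hS hP (ih δ hδ))).congr hS fun z hz => ?_
    have h1 := hκ z hz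
    rw [huv a z hz] at h1
    linear_combination h1

/-- Descent of tameness along a map that is compatible with the weighted derivatives. -/
theorem TameOfOrder.of_comp {H : Set (Cn d)} (hS : IsOpen S) (hH : IsOpen H)
    (hP : ∀ z ∈ S, 1 ≤ P z) {π : Cn d → Cn d}
    (hπ : Set.SurjOn π H S) (hmap : Set.MapsTo π H S) {b q : Fin d × Bool → Cn d → ℂ}
    (hc : ∀ a, ContDiffOn ℝ ∞ (c a) S)
    (hq : ∀ a x, ∀ g : Cn d → ℂ, x ∈ H → DifferentiableAt ℝ g (π x) →
      wirt a (g ∘ π) x = q a x * wirt a g (π x))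
    {κ : Fin d × Bool → ℂ} (hκ : ∀ a, ∀ x ∈ H, c a (π x) = κ a * (b a x * q a x))
    (hg : ContDiffOn ℝ ∞ g S) (h : TameOfOrder H (P ∘ π) b n (g ∘ π)) :
    TameOfOrder S P c n g := by
  have hP' : ∀ x ∈ H, 1 ≤ (P ∘ π) x := fun x hx => hP _ (hmap hx)
  have hb : ∀ {g : Cn d → ℂ}, BoundedByPower H (P ∘ π) (g ∘ π) → BoundedByPower S P g := by
    rintro g ⟨N, C, h⟩
    refine ⟨N, C, fun z hz => ?_⟩
    obtain ⟨x, hx, rfl⟩ := hπ hz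
    exact h x hx
  induction n generalizing g with
  | zero => exact ⟨hg, hb h.2⟩
  | succ n ih =>
    -- The pull-back of c_a ∂_a g is κ_a b_a ∂_a (g ∘ π), so the induction hypothesis applies to it;
    -- the bounds themselves descend by surjectivity.
    refine ⟨⟨hg, hb h.1.2⟩, fun a => ih ((hc a).mul (contDiffOn_wirt hS a hg)) ?_⟩
    refine ((tameOfOrder_const hH (κ a)).mul hH hP' (h.2 a)).congr hH fun x hx => ?_
    simp only [Function.comp_apply]
    rw [hq a x g hx (differentiableAt_of_contDiffOn hS hg (hmap hx)), hκ a x hx]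
    ring

end Tame

/-! ### Wedge products of covectors -/

section Wedge

variable {d n : ℕ}

theorem wedge_apply (η : Fin n → (Cn d →L[ℝ] ℂ)) (v : Fin n → Cn d) :
    wedge η v = Matrix.det (Matrix.of fun i j => η i (v j)) := by
  rw [wedge, ContinuousMultilinearMap.alternatization_apply_apply,
    ← Matrix.det_transpose, Matrix.det_apply]
  rfl

theorem wedge_smul (x : Fin n → ℂ) (ξ : Fin n → (Cn d →L[ℝ] ℂ)) :
    wedge (fun j => x j • ξ j) = (∏ j, x j) • wedge ξ := by
  ext v
  rw [ContinuousAlternatingMap.smul_apply, wedge_apply, wedge_apply]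
  exact Matrix.detRowAlternating.toMultilinearMap.map_smul_univ x fun i j => ξ i (v j)

theorem wedge_sum {ι : Type*} [Fintype ι] (C : Fin n → ι → ℂ) (ξ : ι → (Cn d →L[ℝ] ℂ)) :
    wedge (fun j => ∑ a, C j a • ξ a) =
      ∑ s : Fin n → ι, (∏ j, C j (s j)) • wedge (fun j => ξ (s j)) := by
  classical
  ext v
  rw [ContinuousAlternatingMap.sum_apply, wedge_apply]
  have e : (fun i j => (∑ a, C i a • ξ a) (v j)) = fun i => ∑ a, C i a • fun j => ξ a (v j) := by
    ext i j
    simp [sum_apply, Finset.sum_apply]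
  rw [e]
  refine (Matrix.detRowAlternating.toMultilinearMap.map_sum _).trans
    (Finset.sum_congr rfl fun s _ => ?_)
  rw [ContinuousAlternatingMap.smul_apply, wedge_apply]
  exact Matrix.detRowAlternating.toMultilinearMap.map_smul_univ (fun j => C j (s j))
    fun i j => ξ (s i) (v j)

theorem wedge_eq_zero {ξ : Fin n → (Cn d →L[ℝ] ℂ)} {i j : Fin n} (hij : i ≠ j)
    (h : ξ i = ξ j) : wedge ξ = 0 := by
  ext v
  rw [wedge_apply]
  exact Matrix.det_zero_of_row_eq hij (funext fun k => DFunLike.congr_fun h (v k))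

/-- Laplace expansion of the determinant along its first row. -/
theorem alternatizeUncurryFin_smulRight_wedge (ξ : Cn d →L[ℝ] ℂ)
    (η : Fin n → (Cn d →L[ℝ] ℂ)) :
    ContinuousAlternatingMap.alternatizeUncurryFin (ξ.smulRight (wedge η)) =
      wedge (Fin.cons ξ η : Fin (n + 1) → (Cn d →L[ℝ] ℂ)) := by
  ext v
  rw [ContinuousAlternatingMap.alternatizeUncurryFin_apply, wedge_apply,
    Matrix.det_succ_row_zero]
  refine Finset.sum_congr rfl fun j _ => ?_
  rw [ContinuousLinearMap.smulRight_apply, ContinuousAlternatingMap.smul_apply, wedge_apply]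
  simp only [smul_eq_mul, zsmul_eq_mul, Int.cast_pow, Int.cast_neg, Int.cast_one,
    mul_assoc]
  rfl

/-- Expansion of an alternating form in a real frame `R` with dual coframe `p`. -/
theorem eq_sum_wedge {ι : Type*} [Fintype ι] (p : ι → (Cn d →L[ℝ] ℝ)) (R : ι → Cn d)
    (hR : ∀ v, v = ∑ b, p b v • R b) (φ : AltForm d n) :
    φ = ∑ r : Fin n → ι, ((n.factorial : ℂ)⁻¹ * φ (fun j => R (r j))) •
      wedge (fun j => Complex.ofRealCLM.comp (p (r j))) := by
  classical
  have expand : ∀ v, φ v = ∑ r : Fin n → ι, (∏ j, (p (r j) (v j) : ℂ)) * φ (fun j => R (r j)) := by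
    intro v
    have e : v = fun j => ∑ b, p b (v j) • R b := funext fun j => hR (v j)
    conv_lhs => rw [e]
    refine (φ.toMultilinearMap.map_sum _).trans (Finset.sum_congr rfl fun r _ => ?_)
    refine (φ.toMultilinearMap.map_smul_univ (fun j => p (r j) (v j)) fun j => R (r j)).trans ?_
    rw [Complex.real_smul, Complex.ofReal_prod]
    rfl
  ext v
  -- All n! signed permuted values equal φ v. Averaging over them produces determinants; the factor
  -- 1/n! compensates for summing over all r and not only increasing ones.
  have h1 : (n.factorial : ℂ) * φ v =
      ∑ σ : Equiv.Perm (Fin n), (Equiv.Perm.sign σ : ℤ) • φ (v ∘ σ) := by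
    have : ∀ σ : Equiv.Perm (Fin n), (Equiv.Perm.sign σ : ℤ) • φ (v ∘ σ) = φ v := by
      intro σ
      have h2 := φ.toAlternatingMap.map_perm v σ
      have h3 : φ (v ∘ σ) = (Equiv.Perm.sign σ : ℤ) • φ v := h2
      rw [h3, smul_smul, ← Units.val_mul, Int.units_mul_self, Units.val_one, one_smul]
    simp [this, Fintype.card_perm]
  have hn : (n.factorial : ℂ) ≠ 0 := by exact_mod_cast n.factorial_ne_zero
  rw [ContinuousAlternatingMap.sum_apply, ← mul_right_inj' hn, h1, Finset.mul_sum]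
  simp only [expand (v ∘ _), Finset.smul_sum]
  rw [Finset.sum_comm]
  refine Finset.sum_congr rfl fun r _ => ?_
  rw [ContinuousAlternatingMap.smul_apply, smul_eq_mul, mul_assoc, mul_inv_cancel_left₀ hn,
    wedge_apply, ← Matrix.det_transpose, Matrix.det_apply,
    Finset.mul_sum]
  refine Finset.sum_congr rfl fun σ _ => ?_
  rw [Units.smul_def, mul_smul_comm, mul_comm]
  rfl

/-- A form that is a combination, with tame coefficients, of products of constant combinations
of the frame `ξ` lies in the algebra generated by the tame functions and `ξ`. -/
theorem isGeneratedBy_of_sum {S : Set (Cn d)} {P : Cn d → ℝ} {c : Fin d × Bool → Cn d → ℂ}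
    (hS : IsOpen S) (hP : ∀ z ∈ S, 1 ≤ P z) {ξ : Fin d × Bool → Cn d → (Cn d →L[ℝ] ℂ)}
    {η : Cn d → AltForm d n} {ι : Type*} [Fintype ι] {F : ι → Cn d → ℂ}
    (hF : ∀ t, Tame S P c (F t)) (C : ι → Fin n → Fin d × Bool → ℂ)
    (h : ∀ z ∈ S, η z = ∑ t, F t z • wedge (fun j => ∑ a, C t j a • ξ a z)) :
    IsGeneratedBy {f | Tame S P c f} ξ S η := by
  -- Multilinearity moves the constants C into the coefficients, where they do not affect tameness.
  refine ⟨fun s z => ∑ t, (∏ j, C t j (s j)) * F t z, fun s => ?_, fun z hz => ?_⟩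
  · exact Tame.sum hS hP _ fun t _ => (tame_const hS _).mul hS hP (hF t)
  · rw [h z hz]
    simp only [wedge_sum, Finset.smul_sum]
    rw [Finset.sum_comm]
    refine Finset.sum_congr rfl fun s _ => ?_
    ext v
    simp only [ContinuousAlternatingMap.sum_apply, ContinuousAlternatingMap.smul_apply,
      smul_eq_mul, Finset.sum_mul]
    refine Finset.sum_congr rfl fun t _ => ?_
    ring

/-! ### The operators `∂` and `∂̄` -/

/-- The operator `∂` for `false`, and `∂̄` for `true`. -/
def dolbeault (b : Bool) (η : Cn d → AltForm d n) : Cn d → AltForm d (n + 1) :=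
  if b then delbar η else del η

/-- Multiplication of the argument by √-1 scales dz_i by √-1 and dz̄_i by -√-1, so the combination
keeps one type and kills the other. -/
theorem half_add_mulI (b : Bool) (L : Cn d →L[ℝ] ℂ) (v : Cn d) :
    (1 / 2 : ℂ) * (L v + (if b then Complex.I else -Complex.I) * L (mulI d v)) =
      ∑ i, wirtCoeff (i, b) L * covector (i, b) v := by
  have h : ∀ v, L v = ∑ a, wirtCoeff a L * covector a v := by
    intro v
    conv_lhs => rw [eq_sum_wirtCoeff L]
    simp [sum_apply]
  rw [h v, h (mulI d v), Finset.mul_sum, ← Finset.sum_add_distrib, Finset.mul_sum,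
    Fintype.sum_prod_type]
  refine Finset.sum_congr rfl fun i _ => ?_
  have e : mulI d v i = Complex.I * v i := rfl
  rw [Fintype.sum_bool]
  cases b
  · simp only [covector, dz_apply, dzbar_apply, e, if_true, Bool.false_eq_true, if_false, map_mul,
      Complex.conj_I]
    linear_combination (-wirtCoeff (i, false) L * v i / 2 +
      wirtCoeff (i, true) L * (starRingEnd ℂ) (v i) / 2) * Complex.I_sq
  · simp only [covector, dz_apply, dzbar_apply, e, if_true, Bool.false_eq_true, if_false, map_mul,
      Complex.conj_I]
    linear_combination (wirtCoeff (i, false) L * v i / 2 -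
      wirtCoeff (i, true) L * (starRingEnd ℂ) (v i) / 2) * Complex.I_sq

theorem dolbeault_apply (b : Bool) (η : Cn d → AltForm d n) (z : Cn d) :
    dolbeault b η z = ContinuousAlternatingMap.alternatizeUncurryFin
      ((1 / 2 : ℂ) • (fderiv ℝ η z +
        (if b then Complex.I else -Complex.I) • (fderiv ℝ η z).comp (mulI d))) := by
  cases b
  · simp only [dolbeault, del, Bool.false_eq_true, if_false]
    refine congrArg (fun L => ContinuousAlternatingMap.alternatizeUncurryFin ((1 / 2 : ℂ) • L))
      (ContinuousLinearMap.ext fun v => ContinuousAlternatingMap.ext fun w => ?_)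
    change _ - Complex.I * _ = _ + -Complex.I * _
    ring
  · simp [dolbeault, delbar]

/-- The wedge products are constant in z, so the derivative falls on the coefficients alone. A
varying frame must first be unscaled. -/
theorem dolbeault_eq_sum {ι : Type*} [Fintype ι] (b : Bool) {η : Cn d → AltForm d n} {z : Cn d}
    {F : ι → Cn d → ℂ} {E : ι → Fin n → (Cn d →L[ℝ] ℂ)}
    (h : η =ᶠ[nhds z] fun z => ∑ t, F t z • wedge (E t))
    (hF : ∀ t, DifferentiableAt ℝ (F t) z) :
    dolbeault b η z = ∑ t, ∑ i, wirt (i, b) (F t) z •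
      wedge (Fin.cons (covector (i, b)) (E t) : Fin (n + 1) → (Cn d →L[ℝ] ℂ)) := by
  have hd : fderiv ℝ η z = ∑ t, (fderiv ℝ (F t) z).smulRight (wedge (E t)) := by
    refine (HasFDerivAt.congr_of_eventuallyEq ?_ h).fderiv
    exact HasFDerivAt.fun_sum fun t _ => (hF t).hasFDerivAt.smul_const (wedge (E t))
  have hL : (1 / 2 : ℂ) • (fderiv ℝ η z +
        (if b then Complex.I else -Complex.I) • (fderiv ℝ η z).comp (mulI d)) =
      ∑ t, ∑ i, wirt (i, b) (F t) z • (covector (i, b)).smulRight (wedge (E t)) := by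
    refine ContinuousLinearMap.ext fun v => ?_
    have := fun t => half_add_mulI b (fderiv ℝ (F t) z) v
    simp only [hd, smul_apply, add_apply, sum_apply, ContinuousLinearMap.comp_apply,
      ContinuousLinearMap.smulRight_apply, wirt, smul_smul, ← Finset.sum_smul, ← this,
      Finset.smul_sum, ← Finset.sum_add_distrib]
    refine Finset.sum_congr rfl fun t _ => ?_
    rw [← add_smul, smul_smul]
  rw [dolbeault_apply, hL]
  change ContinuousAlternatingMap.alternatizeUncurryFinCLM ℝ (Cn d) ℂ _ = _
  simp only [map_sum]
  refine Finset.sum_congr rfl fun t _ => Finset.sum_congr rfl fun i _ => ?_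
  rw [← alternatizeUncurryFin_smulRight_wedge]
  exact ContinuousAlternatingMap.alternatizeUncurryFin_smul _ _

/-- The algebra generated by the tame functions and the frame `(c a)⁻¹ • covector a` is stable
under `∂` and `∂̄`. -/
theorem IsGeneratedBy.dolbeault {S : Set (Cn d)} {P : Cn d → ℝ} {c : Fin d × Bool → Cn d → ℂ}
    (hS : IsOpen S) (hP : ∀ z ∈ S, 1 ≤ P z) (hc : ∀ a, ContDiffOn ℝ ∞ (c a) S)
    (h0 : ∀ a, ∀ z ∈ S, c a z ≠ 0) (wc : ∀ a b, a ≠ b → IsWeight S (c a) a (c b))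
    {η : Cn d → AltForm d n}
    (h : IsGeneratedBy {f | Tame S P c f} (fun a z => (c a z)⁻¹ • covector a) S η) (b : Bool) :
    IsGeneratedBy {f | Tame S P c f} (fun a z => (c a z)⁻¹ • covector a) S
      (dolbeault b η) := by
  obtain ⟨f, hf, hη⟩ := h
  have hf : ∀ t, Tame S P c (f t) := hf
  -- Q collects the scale factors of the frame, leaving constant covectors.
  set Q : (Fin n → Fin d × Bool) → Cn d → ℂ := fun t z => ∏ j, (c (t j) z)⁻¹ with hQ
  have hinv : ∀ a, ContDiffOn ℝ ∞ (fun z => (c a z)⁻¹) S := fun a => (hc a).inv (h0 a)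
  have hQs : ∀ t, ContDiffOn ℝ ∞ (Q t) S := fun t => contDiffOn_prod fun j _ => hinv (t j)
  have hη' : Set.EqOn η (fun z => ∑ t, (f t z * Q t z) • wedge (fun j => covector (t j))) S := by
    intro z hz
    rw [hη z hz]
    refine Finset.sum_congr rfl fun t _ => ?_
    rw [wedge_smul, smul_smul]
  have hexists : ∀ (t : Fin n → Fin d × Bool) (i : Fin d), ∃ F : Cn d → ℂ, Tame S P c F ∧
      ∀ z ∈ S, wirt (i, b) (fun z => f t z * Q t z) z •
        wedge (Fin.cons (covector (i, b)) (fun j => covector (t j)) :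
          Fin (n + 1) → (Cn d →L[ℝ] ℂ)) =
        F z • wedge (fun j => (c ((Fin.cons (i, b) t : Fin (n + 1) → Fin d × Bool) j) z)⁻¹ •
          covector ((Fin.cons (i, b) t : Fin (n + 1) → Fin d × Bool) j)) := by
    intro t i
    have hcons : (Fin.cons (covector (i, b)) (fun j => covector (t j)) :
        Fin (n + 1) → (Cn d →L[ℝ] ℂ)) =
        fun j => covector ((Fin.cons (i, b) t : Fin (n + 1) → Fin d × Bool) j) := by
      ext1 j
      refine Fin.cases ?_ (fun j => ?_) j <;> simp
    -- A repeated covector makes the term vanish. Otherwise the new index differs from every t j,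
    -- which is what `wc` requires.
    by_cases ht : ∃ j, t j = (i, b)
    · obtain ⟨j, hj⟩ := ht
      refine ⟨fun _ => 0, tame_const hS 0, fun z _ => ?_⟩
      rw [wedge_eq_zero (Fin.succ_ne_zero j).symm (by simp [hj])]
      refine ContinuousAlternatingMap.ext fun v => ?_
      change _ * (0 : ℂ) = 0 * _
      rw [mul_zero, zero_mul]
    · push Not at ht
      obtain ⟨κ, hκ⟩ : IsWeight S (c (i, b)) (i, b) (Q t) :=
        IsWeight.prod hS _ (fun j _ => hinv (t j)) fun j _ =>
          (wc _ _ (ht j).symm).inv hS (hc _) (h0 _)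
      -- From c_a ∂_a (f Q) = (c_a ∂_a f + κ f) Q.
      refine ⟨fun z => c (i, b) z * wirt (i, b) (f t) z + κ * f t z,
        ((hf t).wirt _).add hS hP ((tame_const hS κ).mul hS hP (hf t)), fun z hz => ?_⟩
      rw [wedge_smul, smul_smul, hcons, Fin.prod_univ_succ]
      congr 1
      rw [wirt_mul (differentiableAt_of_contDiffOn hS (hf t).contDiffOn hz)
        (differentiableAt_of_contDiffOn hS (hQs t) hz)]
      simp only [Fin.cons_zero, Fin.cons_succ]
      change _ = _ * (_ * Q t z)
      have h1 := hκ z hz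
      have h2 := h0 (i, b) z hz
      field_simp
      linear_combination f t z * h1
  choose F hF hFe using hexists
  refine isGeneratedBy_of_sum hS hP (ι := (Fin n → Fin d × Bool) × Fin d)
    (F := fun t => F t.1 t.2) (fun t => hF t.1 t.2)
    (fun t j a => if a = (Fin.cons (t.2, b) t.1 : Fin (n + 1) → Fin d × Bool) j then 1 else 0)
    fun z hz => ?_
  rw [dolbeault_eq_sum b (Filter.eventuallyEq_of_mem (hS.mem_nhds hz) hη') fun t =>
    (differentiableAt_of_contDiffOn hS (hf t).contDiffOn hz).mul
      (differentiableAt_of_contDiffOn hS (hQs t) hz), Fintype.sum_prod_type]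
  refine Finset.sum_congr rfl fun t _ => Finset.sum_congr rfl fun i _ => ?_
  rw [hFe t i z hz]
  refine congrArg (fun ξ => F t i z • wedge ξ) (funext fun j => ContinuousLinearMap.ext fun v => ?_)
  simp only [sum_apply, smul_apply, smul_eq_mul, ite_mul, one_mul, zero_mul, Finset.sum_ite_eq',
    Finset.mem_univ, if_true]

end Wedge

/-! ### The weights of the two frames and the exponential covering -/

section Weights

variable {d : ℕ}

theorem wirtCoeff_sum {ι : Type*} (a : Fin d × Bool) (s : Finset ι)
    (L : ι → (Cn d →L[ℝ] ℂ)) : wirtCoeff a (∑ i ∈ s, L i) = ∑ i ∈ s, wirtCoeff a (L i) := by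
  classical
  induction s using Finset.induction_on with
  | empty => simp
  | insert i s hi ih => rw [Finset.sum_insert hi, Finset.sum_insert hi, wirtCoeff_add, ih]

/-- `Im x_i` for `i < k`, and `1` for the other `i`. -/
def imWeight (k : ℕ) (a : Fin d × Bool) (x : Cn d) : ℂ :=
  if (a.1 : ℕ) < k then ((x a.1).im : ℂ) else 1

/-- `z_i` or `z̄_i` for `i < k`, and `1` for the other `i`. -/
def coordWeight (k : ℕ) (a : Fin d × Bool) (z : Cn d) : ℂ :=
  if (a.1 : ℕ) < k then covector a z else 1

/-- `log (1 / |z_i|)` for `i < k`, and `1` for the other `i`. -/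
def logWeight (k : ℕ) (a : Fin d × Bool) (z : Cn d) : ℂ :=
  if (a.1 : ℕ) < k then (Real.log (1 / ‖z a.1‖) : ℂ) else 1

/-- `z_i log (1 / |z_i|)` or its conjugate for `i < k`, and `1` for the other `i`. -/
def logLogWeight (k : ℕ) (a : Fin d × Bool) (z : Cn d) : ℂ := coordWeight k a z * logWeight k a z

/-- The product of the `log log (1 / |z_i|)`. -/
def logLogProd (k : ℕ) (z : Cn d) : ℝ :=
  |∏ i ∈ divIdx d k, Real.log (Real.log (1 / ‖z i‖))|

/-- The points of `(Δ_r)^k × K` outside of the divisor. -/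
def puncturedPolydisc (k : ℕ) (r : ℝ) (K : Set ({i : Fin d // k ≤ (i : ℕ)} → ℂ)) : Set (Cn d) :=
  {z | z ∈ polydiscProd k r K ∧ ∀ i : Fin d, (i : ℕ) < k → z i ≠ 0}

theorem logLogFrame_eq (k : ℕ) (a : Fin d × Bool) (z : Cn d) :
    logLogFrame k a z = (logLogWeight k a z)⁻¹ • covector a := by
  obtain ⟨i, _ | _⟩ := a <;> by_cases hi : (i : ℕ) < k <;> ext v <;>
    simp [logLogFrame, logLogWeight, coordWeight, logWeight, covector, hi, dz_apply, dzbar_apply]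

theorem imLogFrame_eq (k : ℕ) (a : Fin d × Bool) (x : Cn d) :
    imLogFrame k a x = (imWeight k a x)⁻¹ • covector a := by
  obtain ⟨i, _ | _⟩ := a <;> by_cases hi : (i : ℕ) < k <;> ext v <;>
    simp [imLogFrame, imWeight, covector, hi]

theorem mem_divIdx {k : ℕ} {i : Fin d} : i ∈ divIdx d k ↔ (i : ℕ) < k := by
  simp [divIdx]

theorem norm_monom {k : ℕ} {v : Fin d × Bool → Cn d → ℂ} {z : Cn d} {ρ : Fin d → ℝ}
    (h : ∀ a, ‖v a z‖ = if (a.1 : ℕ) < k then ρ a.1 else 1) (γ : Fin d × Bool → ℕ) :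
    ‖monom v γ z‖ = ∏ i ∈ divIdx d k, ρ i ^ (γ (i, false) + γ (i, true)) := by
  simp only [monom, norm_prod, Fintype.prod_prod_type, Fintype.prod_bool, divIdx,
    Finset.prod_filter]
  refine Finset.prod_congr rfl fun i _ => ?_
  simp only [norm_mul, norm_pow, h]
  split_ifs
  · rw [pow_add, mul_comm]
  · simp

theorem norm_covector (a : Fin d × Bool) (z : Cn d) : ‖covector a z‖ = ‖z a.1‖ := by
  obtain ⟨i, _ | _⟩ := a <;> simp [covector, dz_apply, dzbar_apply]

/-! #### Derivatives of the weights -/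

theorem contDiffOn_coordWeight (k : ℕ) (a : Fin d × Bool) (S : Set (Cn d)) :
    ContDiffOn ℝ ∞ (coordWeight k a) S := by
  unfold coordWeight
  split_ifs
  · exact (covector a).contDiff.contDiffOn
  · exact contDiffOn_const

theorem wirt_coordWeight (k : ℕ) (a b : Fin d × Bool) (z : Cn d) :
    wirt a (coordWeight k b) z = if a = b ∧ (b.1 : ℕ) < k then 1 else 0 := by
  by_cases hb : (b.1 : ℕ) < k
  · have : coordWeight k b = covector b := by ext z; simp [coordWeight, hb]
    rw [this, wirt_of_hasFDerivAt (covector b).hasFDerivAt, wirtCoeff_covector]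
    simp [hb]
  · have : coordWeight k b = fun _ => 1 := by ext z; simp [coordWeight, hb]
    rw [this, wirt_const]
    simp [hb]

theorem isWeight_coordWeight (k : ℕ) (S : Set (Cn d)) (a b : Fin d × Bool) :
    IsWeight S (coordWeight k a) a (coordWeight k b) := by
  refine ⟨if a = b ∧ (b.1 : ℕ) < k then 1 else 0, fun z _ => ?_⟩
  rw [wirt_coordWeight]
  by_cases h : a = b ∧ (b.1 : ℕ) < k
  · simp [h.1]
  · simp [h]

theorem imWeight_eq {k : ℕ} {b : Fin d × Bool} (hb : (b.1 : ℕ) < k) :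
    imWeight k b = ((1 / (2 * Complex.I)) •
      (covector (b.1, false) + (-1 : ℂ) • covector (b.1, true)) : Cn d →L[ℝ] ℂ) := by
  ext x
  have h : (starRingEnd ℂ) (x b.1) = x b.1 - 2 * (x b.1).im * Complex.I := by
    apply Complex.ext <;> simp; ring
  simp only [imWeight, hb, if_true, smul_apply, add_apply, covector, dz_apply, dzbar_apply,
    Bool.false_eq_true, if_false, smul_eq_mul, h]
  field_simp
  ring

theorem contDiffOn_imWeight (k : ℕ) (a : Fin d × Bool) (S : Set (Cn d)) :
    ContDiffOn ℝ ∞ (imWeight k a) S := by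
  by_cases ha : (a.1 : ℕ) < k
  · rw [imWeight_eq ha]
    exact ContinuousLinearMap.contDiff _ |>.contDiffOn
  · have : imWeight k a = fun _ => 1 := by ext z; simp [imWeight, ha]
    rw [this]
    exact contDiffOn_const

/-- Im x_b is real linear, so its derivative is constant; when this is nonzero, the two weights are
the same function. -/
theorem isWeight_imWeight (k : ℕ) (S : Set (Cn d)) (a b : Fin d × Bool) :
    IsWeight S (imWeight k a) a (imWeight k b) := by
  by_cases hb : (b.1 : ℕ) < k
  · refine ⟨wirtCoeff a ((1 / (2 * Complex.I)) •
      (covector (b.1, false) + (-1 : ℂ) • covector (b.1, true))), fun z _ => ?_⟩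
    have h : wirt a (imWeight k b) z = wirtCoeff a ((1 / (2 * Complex.I)) •
        (covector (b.1, false) + (-1 : ℂ) • covector (b.1, true))) := by
      rw [imWeight_eq hb]
      exact wirt_of_hasFDerivAt (ContinuousLinearMap.hasFDerivAt _)
    rw [h, mul_comm]
    by_cases hab : a.1 = b.1
    · have : imWeight k a z = imWeight k b z := by simp [imWeight, hab]
      rw [this]
    · have h1 : a ≠ (b.1, false) := fun h => hab (by rw [h])
      have h2 : a ≠ (b.1, true) := fun h => hab (by rw [h])
      simp only [wirtCoeff_smul, wirtCoeff_add, wirtCoeff_covector, h1, h2, if_false, mul_zero,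
        add_zero, zero_mul]
  · have : imWeight k b = fun _ => 1 := by ext z; simp [imWeight, hb]
    rw [this]
    exact isWeight_const _ _ _

/-- From log(1/|z|) = -(1/2) log(z z̄). -/
theorem hasFDerivAt_log_inv_norm (i : Fin d) {z : Cn d} (hz : z i ≠ 0) :
    HasFDerivAt (fun z : Cn d => (Real.log (1 / ‖z i‖) : ℂ))
      ((-1 / 2 : ℂ) • ((covector (i, false) z)⁻¹ • covector (i, false) +
        (covector (i, true) z)⁻¹ • covector (i, true))) z := by
  have h0 : ‖z i‖ ^ 2 ≠ 0 := by simpa using hz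
  have h1 : HasFDerivAt (fun z : Cn d => z i) (dz i) z := (dz i).hasFDerivAt
  have h2 := ((h1.norm_sq.log h0).const_mul (-1 / 2 : ℝ))
  have h3 := (Complex.ofRealCLM.hasFDerivAt).comp z h2
  refine (h3.congr_fderiv ?_).congr_of_eventuallyEq (Filter.Eventually.of_forall fun w => ?_)
  · ext v
    have e : ((‖z i‖ ^ 2 : ℝ) : ℂ) = z i * (starRingEnd ℂ) (z i) := by
      rw [Complex.mul_conj, Complex.normSq_eq_norm_sq]
    have h4 : (starRingEnd ℂ) (z i) ≠ 0 := by simpa using hz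
    have e2 : ((((starRingEnd ℂ) (z i)) * v i).re : ℂ) =
        ((starRingEnd ℂ) (z i) * v i + z i * (starRingEnd ℂ) (v i)) / 2 := by
      rw [Complex.re_eq_add_conj, map_mul, Complex.conj_conj]
    simp only [ContinuousLinearMap.comp_apply, smul_apply, add_apply, covector, dz_apply,
      dzbar_apply, Bool.false_eq_true, if_false, if_true, smul_eq_mul, innerSL_apply_apply,
      Complex.inner, Complex.ofRealCLM_apply, Complex.ofReal_mul, Complex.ofReal_inv, e, nsmul_eq_mul]
    rw [mul_comm (v i), e2]
    push_cast
    field_simp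
  · simp only [Function.comp_apply, Complex.ofRealCLM_apply]
    congr 1
    rw [Real.log_pow, one_div, Real.log_inv]
    push_cast
    ring

theorem wirt_logWeight {k : ℕ} (a b : Fin d × Bool) {z : Cn d}
    (hz : ∀ i : Fin d, (i : ℕ) < k → z i ≠ 0) : wirt a (logWeight k b) z =
      if a.1 = b.1 ∧ (b.1 : ℕ) < k then (-1 / 2) * (coordWeight k a z)⁻¹ else 0 := by
  by_cases hb : (b.1 : ℕ) < k
  · have : logWeight k b = fun z => (Real.log (1 / ‖z b.1‖) : ℂ) := by ext z; simp [logWeight, hb]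
    rw [this, wirt_of_hasFDerivAt (hasFDerivAt_log_inv_norm b.1 (hz b.1 hb))]
    simp only [wirtCoeff_smul, wirtCoeff_add, wirtCoeff_covector]
    by_cases hab : a.1 = b.1
    · obtain ⟨i, s⟩ := a
      obtain rfl : i = b.1 := hab
      cases s <;> simp [coordWeight, hb]
    · have h1 : a ≠ (b.1, false) := fun h => hab (by rw [h])
      have h2 : a ≠ (b.1, true) := fun h => hab (by rw [h])
      simp [h1, h2, hab]
  · have : logWeight k b = fun _ => 1 := by ext z; simp [logWeight, hb]
    rw [this, wirt_const]
    simp [hb]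

theorem coordWeight_ne_zero {k : ℕ} (a : Fin d × Bool) {z : Cn d}
    (hz : ∀ i : Fin d, (i : ℕ) < k → z i ≠ 0) : coordWeight k a z ≠ 0 := by
  unfold coordWeight
  split_ifs with h
  · rw [← norm_ne_zero_iff, norm_covector, norm_ne_zero_iff]
    exact hz _ h
  · exact one_ne_zero

variable {S : Set (Cn d)} {k : ℕ}

theorem contDiffOn_logWeight (hz : ∀ z ∈ S, ∀ i : Fin d, (i : ℕ) < k → z i ≠ 0)
    (a : Fin d × Bool) : ContDiffOn ℝ ∞ (logWeight k a) S := by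
  by_cases ha : (a.1 : ℕ) < k
  · have : logWeight k a = fun z => Complex.ofRealCLM (-1 / 2 * Real.log (‖z a.1‖ ^ 2)) := by
      ext z
      simp only [logWeight, ha, if_true, Real.log_pow, one_div, Real.log_inv,
        Complex.ofRealCLM_apply]
      push_cast
      ring
    rw [this]
    refine Complex.ofRealCLM.contDiff.comp_contDiffOn (contDiffOn_const.mul (ContDiffOn.log ?_ ?_))
    · exact ((dz a.1).contDiff.norm_sq ℝ).contDiffOn
    · intro z h
      simpa using hz z h _ ha
  · have : logWeight k a = fun _ => 1 := by ext z; simp [logWeight, ha]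
    rw [this]
    exact contDiffOn_const

/-- The coordinate in the operator cancels the pole of ∂ log(1/|z_i|) = -1/(2 z_i), leaving -1/2
times the logarithm. -/
theorem isWeight_logWeight (hz : ∀ z ∈ S, ∀ i : Fin d, (i : ℕ) < k → z i ≠ 0)
    (a b : Fin d × Bool) : IsWeight S (logLogWeight k a) a (logWeight k b) := by
  refine ⟨if a.1 = b.1 ∧ (b.1 : ℕ) < k then -1 / 2 else 0, fun z h => ?_⟩
  rw [wirt_logWeight a b (hz z h), logLogWeight]
  have := coordWeight_ne_zero a (hz z h)
  split_ifs with hab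
  · have e : logWeight k a z = logWeight k b z := by simp [logWeight, hab.1]
    rw [e]
    field_simp
  · simp

theorem contDiffOn_logLogWeight (hz : ∀ z ∈ S, ∀ i : Fin d, (i : ℕ) < k → z i ≠ 0)
    (a : Fin d × Bool) : ContDiffOn ℝ ∞ (logLogWeight k a) S :=
  (contDiffOn_coordWeight k a S).mul (contDiffOn_logWeight hz a)

/-- For a ≠ b the operator kills the coordinate factor and scales the logarithm. For a = b and i < k
this fails: with L = log(1/|z|), z L ∂_z (z L) = (L - 1/2) z L. -/
theorem isWeight_logLogWeight (hS : IsOpen S)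
    (hz : ∀ z ∈ S, ∀ i : Fin d, (i : ℕ) < k → z i ≠ 0) (a b : Fin d × Bool) (hab : a ≠ b) :
    IsWeight S (logLogWeight k a) a (logLogWeight k b) := by
  refine IsWeight.mul hS (contDiffOn_coordWeight k b S) (contDiffOn_logWeight hz b) ?_
    (isWeight_logWeight hz a b)
  exact ⟨0, fun z _ => by simp [wirt_coordWeight, hab]⟩

/-- The radius e^{-e} of adapted coordinates is what makes the gauge at least 1. -/
theorem one_le_log_log {t : ℝ} (h0 : 0 < t) (h : t ≤ 1 / Real.exp (Real.exp 1)) :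
    Real.exp 1 ≤ Real.log (1 / t) ∧ 1 ≤ Real.log (Real.log (1 / t)) := by
  have h1 : Real.exp 1 ≤ Real.log (1 / t) := by
    rw [Real.le_log_iff_exp_le (by positivity), le_div_iff₀ h0]
    rwa [le_div_iff₀ (Real.exp_pos _), mul_comm] at h
  exact ⟨h1, (Real.le_log_iff_exp_le ((Real.exp_pos 1).trans_le h1)).2 h1⟩

theorem one_le_logLogProd (hz : ∀ z ∈ S, ∀ i : Fin d, (i : ℕ) < k → z i ≠ 0)
    (hr : ∀ z ∈ S, ∀ i : Fin d, ‖z i‖ ≤ 1 / Real.exp (Real.exp 1)) (z : Cn d) (h : z ∈ S) :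
    1 ≤ logLogProd k z := by
  refine le_trans ?_ (le_abs_self _)
  refine Finset.prod_induction _ (1 ≤ ·) (fun _ _ => one_le_mul_of_one_le_of_one_le) le_rfl
    fun i hi => ?_
  exact (one_le_log_log (norm_pos_iff.2 (hz z h i (mem_divIdx.1 hi))) (hr z h i)).2

theorem logWeight_bound (hz : ∀ z ∈ S, ∀ i : Fin d, (i : ℕ) < k → z i ≠ 0)
    (hr : ∀ z ∈ S, ∀ i : Fin d, ‖z i‖ ≤ 1 / Real.exp (Real.exp 1)) (a : Fin d × Bool) (z : Cn d)
    (h : z ∈ S) : 1 ≤ ‖logWeight k a z‖ := by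
  unfold logWeight
  split_ifs with ha
  · have h1 := (one_le_log_log (norm_pos_iff.2 (hz z h _ ha)) (hr z h a.1)).1
    rw [Complex.norm_real]
    exact ((Real.add_one_le_exp 1).trans' (by norm_num)).trans (h1.trans (le_abs_self _))
  · simp

theorem logLogWeight_ne_zero (hz : ∀ z ∈ S, ∀ i : Fin d, (i : ℕ) < k → z i ≠ 0)
    (hr : ∀ z ∈ S, ∀ i : Fin d, ‖z i‖ ≤ 1 / Real.exp (Real.exp 1)) (a : Fin d × Bool) (z : Cn d)
    (h : z ∈ S) : logLogWeight k a z ≠ 0 :=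
  mul_ne_zero (coordWeight_ne_zero a (hz z h))
    (norm_pos_iff.1 (one_pos.trans_le (logWeight_bound hz hr a z h)))

/-- The tame functions have log-log growth of infinite order. -/
theorem Tame.mem_logLogFunctions (hS : IsOpen S)
    (hz : ∀ z ∈ S, ∀ i : Fin d, (i : ℕ) < k → z i ≠ 0)
    (hr : ∀ z ∈ S, ∀ i : Fin d, ‖z i‖ ≤ 1 / Real.exp (Real.exp 1)) {f : Cn d → ℂ}
    (hf : Tame S (logLogProd k) (logLogWeight k) f) : f ∈ logLogFunctions k S := by
  have hP := one_le_logLogProd hz hr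
  have hne : ∀ a, ∀ z ∈ S, logWeight k a z ≠ 0 := fun a z h =>
    norm_pos_iff.1 (one_pos.trans_le (logWeight_bound hz hr a z h))
  have hinv : ∀ a, Tame S (logLogProd k) (logLogWeight k) (fun z => (logWeight k a z)⁻¹) := by
    intro a
    refine tame_of_isWeight hS hP ((contDiffOn_logWeight hz a).inv (hne a))
      (boundedByPower_of_norm_le 1 fun z h => ?_)
      fun b => (isWeight_logWeight hz b a).inv hS (contDiffOn_logWeight hz a) (hne a)
    rw [norm_inv]
    exact inv_le_one_of_one_le₀ (logWeight_bound hz hr a z h)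
  -- The weights change from z log(1/|z|) to z, which is an eigenfunction of its own operator; the
  -- ratio 1/log(1/|z|) is tame by `hinv`.
  have key : ∀ γ, Tame S (logLogProd k) (logLogWeight k)
      (fun z => monom (coordWeight k) γ z * iterWirt γ f z) :=
    tame_weighted_deriv hS hP (fun a => contDiffOn_coordWeight k a S)
      (isWeight_coordWeight k S) hinv
      (fun a z h => by rw [logLogWeight, mul_comm, mul_assoc, mul_inv_cancel₀ (hne a z h), mul_one])
      hf
  refine ⟨hf.contDiffOn, fun m => ?_⟩
  choose N hN using fun γ => (key γ).boundedByPower.exists_pos hP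
  -- The exponent may depend on m only, so the maximum over the finitely many γ of order at most m
  -- is taken.
  have hfin : {γ : Fin d × Bool → ℕ | ∑ a, γ a ≤ m}.Finite := by
    refine (Set.finite_Iic (fun _ : Fin d × Bool => m)).subset fun γ hγ a => ?_
    exact (Finset.single_le_sum (fun _ _ => Nat.zero_le _) (Finset.mem_univ a)).trans hγ
  refine ⟨hfin.toFinset.sup N, fun α β hαβ => ?_⟩
  let γ : Fin d × Bool → ℕ := fun a => if a.2 then β a.1 else α a.1
  have hγ : γ ∈ hfin.toFinset := by
    rw [Set.Finite.mem_toFinset, Set.mem_ofPred_eq, Fintype.sum_prod_type]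
    simpa [γ, add_comm] using hαβ
  obtain ⟨C, hC, h⟩ := hN γ _ (Finset.le_sup hγ)
  refine ⟨C, hC, fun z hzS => ?_⟩
  have hz' := hz z hzS
  have hn : ‖monom (coordWeight k) γ z‖ = ∏ i ∈ divIdx d k, ‖z i‖ ^ (α i + β i) := by
    rw [norm_monom (k := k) (ρ := fun i => ‖z i‖) (fun a => ?_)]
    · simp [γ]
    · unfold coordWeight
      split_ifs
      · exact norm_covector a z
      · simp
  have hpos : 0 < ∏ i ∈ divIdx d k, ‖z i‖ ^ (α i + β i) :=
    Finset.prod_pos fun i hi => pow_pos (norm_pos_iff.2 (hz' i (mem_divIdx.1 hi))) _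
  rw [mul_div_assoc', le_div_iff₀ hpos, ← hn, mul_comm, ← norm_mul]
  exact h z hzS

end Weights

section Covering

variable {d : ℕ}

/-! ### The exponential covering -/

/-- The factor of the chain rule for the exponential covering. -/
def expFactor (k : ℕ) (a : Fin d × Bool) (x : Cn d) : ℂ :=
  if (a.1 : ℕ) < k then
    (if a.2 then -(2 * Real.pi * Complex.I) else 2 * Real.pi * Complex.I) *
      covector a (expCover k x) else 1

/-- The derivative of the exponential covering. -/
def expDeriv (k : ℕ) (x : Cn d) : Cn d →L[ℝ] Cn d :=
  ContinuousLinearMap.pi fun i => expFactor k (i, false) x • dz i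

theorem expDeriv_apply (k : ℕ) (x v : Cn d) (i : Fin d) :
    expDeriv k x v i = expFactor k (i, false) x * v i := rfl

theorem hasFDerivAt_expCover (k : ℕ) (x : Cn d) :
    HasFDerivAt (expCover k) (expDeriv k x) x := by
  refine hasFDerivAt_pi.2 fun i => ?_
  have h1 : HasFDerivAt (fun x : Cn d => x i) (dz i) x := (dz i).hasFDerivAt
  by_cases hi : (i : ℕ) < k
  · have h2 := (h1.const_mul (2 * Real.pi * Complex.I)).cexp
    simp only [expCover, hi, if_true]
    refine h2.congr_fderiv ?_
    ext v
    simp [expFactor, hi, covector, dz_apply, expCover]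
    ring
  · simp only [expCover, hi, if_false]
    refine h1.congr_fderiv ?_
    ext v
    simp [expFactor, hi]

theorem covector_comp_expDeriv (k : ℕ) (x : Cn d) (a : Fin d × Bool) (v : Cn d) :
    covector a (expDeriv k x v) = expFactor k a x * covector a v := by
  obtain ⟨i, _ | _⟩ := a <;> by_cases hi : (i : ℕ) < k <;>
    simp [covector, dz_apply, dzbar_apply, expDeriv_apply, expFactor, hi, map_ofNat (starRingEnd ℂ) 2]

/-- The covering is holomorphic and acts on each coordinate separately, so its derivative is
diagonal in the covectors and mixes no types. -/
theorem wirt_comp_expCover (k : ℕ) (a : Fin d × Bool) (x : Cn d) (g : Cn d → ℂ)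
    (hg : DifferentiableAt ℝ g (expCover k x)) :
    wirt a (g ∘ expCover k) x = expFactor k a x * wirt a g (expCover k x) := by
  rw [wirt_of_hasFDerivAt (hg.hasFDerivAt.comp x (hasFDerivAt_expCover k x))]
  have e : (fderiv ℝ g (expCover k x)).comp (expDeriv k x) =
      ∑ b, (wirtCoeff b (fderiv ℝ g (expCover k x)) * expFactor k b x) • covector b := by
    ext v
    rw [ContinuousLinearMap.comp_apply]
    conv_lhs => rw [eq_sum_wirtCoeff (fderiv ℝ g (expCover k x))]
    simp only [sum_apply, smul_apply, smul_eq_mul, covector_comp_expDeriv, mul_assoc]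
  rw [e, wirtCoeff_sum]
  simp [wirtCoeff_covector, wirt, mul_comm]

theorem log_inv_norm_expCover {k : ℕ} {i : Fin d} (hi : (i : ℕ) < k) (x : Cn d) :
    Real.log (1 / ‖expCover k x i‖) = 2 * Real.pi * (x i).im := by
  simp [expCover, hi, Complex.norm_exp]

/-- The logarithm contributes 2π Im x, and 2π times the coordinate is the chain rule factor up to
±√-1. Hence the weighted operators upstairs and downstairs correspond up to constants. -/
theorem logLogWeight_expCover (k : ℕ) (a : Fin d × Bool) (x : Cn d) :
    logLogWeight k a (expCover k x) =
      (if (a.1 : ℕ) < k then (if a.2 then Complex.I else -Complex.I) else 1) *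
        (imWeight k a x * expFactor k a x) := by
  by_cases ha : (a.1 : ℕ) < k
  · simp only [logLogWeight, coordWeight, logWeight, imWeight, expFactor, ha, if_true,
      log_inv_norm_expCover ha]
    push_cast
    cases a.2
    · simp only [Bool.false_eq_true, if_false]
      linear_combination (2 * Real.pi * (x a.1).im * covector a (expCover k x)) * Complex.I_sq
    · simp only [if_true]
      linear_combination (2 * Real.pi * (x a.1).im * covector a (expCover k x)) * Complex.I_sq
  · simp [logLogWeight, coordWeight, logWeight, imWeight, expFactor, ha]

variable {k : ℕ} {M : ℝ} {K : Set ({i : Fin d // k ≤ (i : ℕ)} → ℂ)}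

theorem norm_expCover {i : Fin d} (hi : (i : ℕ) < k) (x : Cn d) :
    ‖expCover k x i‖ = Real.exp (-2 * Real.pi * (x i).im) := by
  simp [expCover, hi, Complex.norm_exp]

theorem restrict_expCover (x : Cn d) :
    (fun i : {i : Fin d // k ≤ (i : ℕ)} => expCover k x i) =
      fun i : {i : Fin d // k ≤ (i : ℕ)} => x i := by
  ext i
  simp [expCover, not_lt.2 i.2]

theorem mapsTo_expCover : Set.MapsTo (expCover k) (halfPlaneProd k M K)
    (puncturedPolydisc k (Real.exp (-2 * Real.pi * M)) K) := by
  rintro x ⟨h1, h2⟩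
  refine ⟨⟨fun i hi => ?_, ?_⟩, fun i hi => ?_⟩
  · rw [norm_expCover hi, Real.exp_lt_exp]
    have := h1 i hi
    have := Real.pi_pos
    nlinarith
  · rw [restrict_expCover]
    exact h2
  · simp [expCover, hi]

theorem surjOn_expCover : Set.SurjOn (expCover k) (halfPlaneProd k M K)
    (puncturedPolydisc k (Real.exp (-2 * Real.pi * M)) K) := by
  rintro z ⟨⟨h1, h2⟩, h3⟩
  have hpi : (2 * Real.pi * Complex.I : ℂ) ≠ 0 := by simp [Real.pi_ne_zero]
  -- The discontinuous principal branch is enough, since only a preimage of a single point is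
  -- needed.
  let x : Cn d := fun i => if (i : ℕ) < k then Complex.log (z i) / (2 * Real.pi * Complex.I) else z i
  have hx : expCover k x = z := by
    ext i
    by_cases hi : (i : ℕ) < k
    · simp only [expCover, x, hi, if_true]
      rw [mul_div_cancel₀ _ hpi, Complex.exp_log (h3 i hi)]
    · simp [expCover, x, hi]
  refine ⟨x, ⟨fun i hi => ?_, ?_⟩, hx⟩
  · have h := h1 i hi
    rw [← hx, norm_expCover hi, Real.exp_lt_exp] at h
    have := Real.pi_pos
    by_contra! hc
    nlinarith
  · rw [← restrict_expCover, hx]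
    exact h2

theorem isOpen_halfPlaneProd (hK : IsOpen K) : IsOpen (halfPlaneProd k M K) := by
  refine IsOpen.inter ?_ (hK.preimage (by fun_prop))
  have : {x : Cn d | ∀ i : Fin d, (i : ℕ) < k → M < (x i).im} =
      ⋂ i : Fin d, {x | (i : ℕ) < k → M < (x i).im} := by ext; simp
  change IsOpen {x : Cn d | ∀ i : Fin d, (i : ℕ) < k → M < (x i).im}
  rw [this]
  refine isOpen_iInter_of_finite fun i => ?_
  by_cases hi : (i : ℕ) < k
  · simp only [hi, true_imp_iff]
    exact isOpen_lt continuous_const (Complex.continuous_im.comp (continuous_apply i))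
  · simp [hi]

theorem isOpen_puncturedPolydisc (hK : IsOpen K) (r : ℝ) : IsOpen (puncturedPolydisc k r K) := by
  have : puncturedPolydisc k r K = (⋂ i : Fin d, {z | (i : ℕ) < k → ‖z i‖ < r ∧ z i ≠ 0}) ∩
      {z | (fun i : {i : Fin d // k ≤ (i : ℕ)} => z i) ∈ K} := by
    ext z
    simp only [puncturedPolydisc, polydiscProd, Set.mem_inter_iff, Set.mem_iInter,
      Set.mem_ofPred_eq]
    constructor
    · exact fun h => ⟨fun i hi => ⟨h.1.1 i hi, h.2 i hi⟩, h.1.2⟩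
    · exact fun h => ⟨⟨fun i hi => (h.1 i hi).1, h.2⟩, fun i hi => (h.1 i hi).2⟩
  rw [this]
  refine IsOpen.inter (isOpen_iInter_of_finite fun i => ?_) (hK.preimage (by fun_prop))
  by_cases hi : (i : ℕ) < k
  · simp only [hi, true_imp_iff]
    exact (isOpen_lt (continuous_apply i).norm continuous_const).inter
      (isOpen_ne_fun (continuous_apply i) continuous_const)
  · simp [hi]

/-- Imaginary logarithmic growth implies tameness. -/
theorem tame_of_mem_imLogFunctions (hK : IsOpen K) (hM : 1 < M)
    (hP : ∀ x ∈ halfPlaneProd k M K, 1 ≤ logLogProd k (expCover k x)) {f : Cn d → ℂ}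
    (hf : f ∈ imLogFunctions k (halfPlaneProd k M K)) :
    Tame (halfPlaneProd k M K) (logLogProd k ∘ expCover k) (imWeight k) f := by
  obtain ⟨hf, N, hN⟩ := hf
  refine tame_of_weighted_deriv (isOpen_halfPlaneProd hK) hP
    (fun a => contDiffOn_imWeight k a _) (isWeight_imWeight k _) hf fun γ => ?_
  obtain ⟨C, hC, h⟩ := hN (fun i => γ (i, false)) (fun i => γ (i, true))
  refine ⟨N (∑ i, (γ (i, false) + γ (i, true))), C, fun x hx => ?_⟩
  have him : ∀ i ∈ divIdx d k, 1 < (x i).im := fun i hi => hM.trans (hx.1 i (mem_divIdx.1 hi))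
  have hn : ‖monom (imWeight k) γ x‖ =
      ∏ i ∈ divIdx d k, (x i).im ^ (γ (i, false) + γ (i, true)) := by
    rw [norm_monom (k := k) (ρ := fun i => |(x i).im|) (fun a => ?_)]
    · refine Finset.prod_congr rfl fun i hi => ?_
      rw [abs_of_pos (one_pos.trans (him i hi))]
    · unfold imWeight
      split_ifs <;> simp
  have hpos : 0 < ∏ i ∈ divIdx d k, (x i).im ^ (γ (i, false) + γ (i, true)) :=
    Finset.prod_pos fun i hi => pow_pos (one_pos.trans (him i hi)) _
  have h1 := h x hx
  rw [mul_div_assoc', le_div_iff₀ hpos, ← hn, mul_comm, ← norm_mul] at h1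
  refine h1.trans ?_
  -- As Im x > 1 only, log Im x may be close to 0; it is replaced by the larger log(2π Im x) = log
  -- log(1/|z|), which gives the gauge.
  have hle : |∏ i ∈ divIdx d k, Real.log (x i).im| ≤ logLogProd k (expCover k x) := by
    rw [logLogProd, Finset.abs_prod, Finset.abs_prod]
    refine Finset.prod_le_prod (fun _ _ => abs_nonneg _) fun i hi => ?_
    rw [log_inv_norm_expCover (mem_divIdx.1 hi)]
    have h2 := him i hi
    have h3 : 0 ≤ Real.log (x i).im := Real.log_nonneg h2.le
    have h4 : Real.log (x i).im ≤ Real.log (2 * Real.pi * (x i).im) := by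
      refine Real.log_le_log (by linarith) ?_
      nlinarith [Real.pi_gt_three]
    rw [abs_of_nonneg h3, abs_of_nonneg (h3.trans h4)]
    exact h4
  rw [Function.comp_apply]
  gcongr

/-! ### Descent of forms -/

variable {n : ℕ}

/-- The constant matrix of the real frame in terms of the coframe. -/
def realCoframeMatrix (b a : Fin d × Bool) : ℂ :=
  if a.1 = b.1 then
    (if b.2 then (if a.2 then -(1 / (2 * Complex.I)) else 1 / (2 * Complex.I)) else 1 / 2)
  else 0

/-- `1` for `false` and `√-1` for `true`. -/
def realUnit (s : Bool) : ℂ := if s then Complex.I else 1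

/-- The expansion of an alternating form in the real frame obtained by rescaling the standard frame
by the complex numbers `c`. -/
theorem eq_sum_wedge_rescaled (c : Fin d × Bool → ℂ) (hc : ∀ a, c a ≠ 0)
    (hconj : ∀ i, c (i, true) = (starRingEnd ℂ) (c (i, false))) (φ : AltForm d n) :
    φ = ∑ r : Fin n → Fin d × Bool, ((n.factorial : ℂ)⁻¹ *
      φ (fun j => Pi.single (r j).1 (c ((r j).1, false) * realUnit (r j).2))) •
        wedge (fun j => ∑ a, realCoframeMatrix (r j) a • (c a)⁻¹ • covector a) := by
  -- A form is only real multilinear, so the frame must be real: the real and imaginary parts of c⁻¹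
  -- dz_i are dual to c e_i and √-1 c e_i.
  let p : Fin d × Bool → (Cn d →L[ℝ] ℝ) := fun b =>
    (if b.2 then Complex.imCLM else Complex.reCLM).comp ((c (b.1, false))⁻¹ • dz b.1)
  have hp : ∀ b, Complex.ofRealCLM.comp (p b) =
      ∑ a, realCoframeMatrix b a • (c a)⁻¹ • covector a := by
    rintro ⟨i, s⟩
    ext v
    have e : (c (i, true))⁻¹ * (starRingEnd ℂ) (v i) =
        (starRingEnd ℂ) ((c (i, false))⁻¹ * v i) := by
      rw [hconj, map_mul, map_inv₀]
    have hs : (∑ a, realCoframeMatrix (i, s) a • (c a)⁻¹ • covector a) v =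
        realCoframeMatrix (i, s) (i, true) * (starRingEnd ℂ) ((c (i, false))⁻¹ * v i) +
          realCoframeMatrix (i, s) (i, false) * ((c (i, false))⁻¹ * v i) := by
      rw [← e, sum_apply, Fintype.sum_prod_type, Finset.sum_eq_single i]
      · rw [Fintype.sum_bool]
        rfl
      · intro j _ hj
        refine Finset.sum_eq_zero fun t _ => ?_
        change realCoframeMatrix (i, s) (j, t) * _ = 0
        simp [realCoframeMatrix, hj]
      · simp
    rw [hs]
    cases s
    · change (((c (i, false))⁻¹ * v i).re : ℂ) = _
      rw [Complex.re_eq_add_conj]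
      simp only [realCoframeMatrix, if_true, Bool.false_eq_true, if_false]
      ring
    · change (((c (i, false))⁻¹ * v i).im : ℂ) = _
      rw [Complex.im_eq_sub_conj]
      simp only [realCoframeMatrix, if_true, Bool.false_eq_true, if_false]
      ring
  have hR : ∀ v, v = ∑ b, p b v •
      (Pi.single b.1 (c (b.1, false) * realUnit b.2) : Cn d) := by
    intro v
    ext i
    rw [Finset.sum_apply, Fintype.sum_prod_type, Finset.sum_eq_single i]
    · rw [Fintype.sum_bool]
      have h1 := Complex.re_add_im ((c (i, false))⁻¹ * v i)
      have h2 : c (i, false) * ((c (i, false))⁻¹ * v i) = v i :=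
        mul_inv_cancel_left₀ (hc _) _
      rw [← h1] at h2
      simp only [Pi.smul_apply, Pi.single_eq_same, Complex.real_smul, realUnit, if_true,
        Bool.false_eq_true, if_false]
      change v i = (((c (i, false))⁻¹ * v i).im : ℂ) * _ + (((c (i, false))⁻¹ * v i).re : ℂ) * _
      linear_combination -h2
    · intro j _ hj
      refine Finset.sum_eq_zero fun t _ => ?_
      simp [Ne.symm hj]
    · simp
  simp only [← hp]
  exact eq_sum_wedge p _ hR φ

/-- Expansion in the standard real frame separates the values of η on constant vectors from
polynomials in the entries of the moving vectors. -/
theorem contDiffOn_altForm_apply {S : Set (Cn d)} {η : Cn d → AltForm d n}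
    (hη : ContDiffOn ℝ ∞ η S) {R : Fin n → Cn d → Cn d} (hR : ∀ j, ContDiffOn ℝ ∞ (R j) S) :
    ContDiffOn ℝ ∞ (fun z => η z (fun j => R j z)) S := by
  have hconst : ∀ v : Fin n → Cn d, ContDiffOn ℝ ∞ (fun z => η z v) S := fun v =>
    (ContinuousAlternatingMap.apply ℝ (Cn d) ℂ v).contDiff.comp_contDiffOn hη
  have e : ∀ z, η z (fun j => R j z) = ∑ r : Fin n → Fin d × Bool, ((n.factorial : ℂ)⁻¹ *
      η z (fun j => Pi.single (r j).1 (1 * realUnit (r j).2))) *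
        ∑ σ : Equiv.Perm (Fin n), (Equiv.Perm.sign σ : ℤ) •
          ∏ j, (∑ a, realCoframeMatrix (r j) a • covector a) (R (σ j) z) := by
    intro z
    conv_lhs => rw [eq_sum_wedge_rescaled (fun _ => 1) (by simp) (by simp) (η z)]
    rw [ContinuousAlternatingMap.sum_apply]
    refine Finset.sum_congr rfl fun r _ => ?_
    rw [ContinuousAlternatingMap.smul_apply, smul_eq_mul, wedge_apply, ← Matrix.det_transpose,
      Matrix.det_apply]
    simp only [inv_one, one_smul]
    rfl
  simp only [e]
  refine ContDiffOn.sum fun r _ => (contDiffOn_const.mul (hconst _)).mul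
    (ContDiffOn.sum fun σ _ => ContDiffOn.const_smul _ (contDiffOn_prod fun j _ => ?_))
  exact (ContinuousLinearMap.contDiff _).comp_contDiffOn (hR (σ j))

/-- Descent along the exponential covering. -/
theorem isGeneratedBy_of_hasImLogGrowthOn (hK : IsOpen K) (hM : 1 < M)
    (hr : ∀ z ∈ puncturedPolydisc k (Real.exp (-2 * Real.pi * M)) K, ∀ i : Fin d,
      ‖z i‖ ≤ 1 / Real.exp (Real.exp 1)) {η : Cn d → AltForm d n}
    (hη : ContDiffOn ℝ ∞ η (puncturedPolydisc k (Real.exp (-2 * Real.pi * M)) K))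
    (h : HasImLogGrowthOn k (halfPlaneProd k M K) (pullbackExp k η)) :
    IsGeneratedBy {f | Tame (puncturedPolydisc k (Real.exp (-2 * Real.pi * M)) K) (logLogProd k)
      (logLogWeight k) f} (fun a z => (logLogWeight k a z)⁻¹ • covector a)
      (puncturedPolydisc k (Real.exp (-2 * Real.pi * M)) K) η := by
  set S := puncturedPolydisc k (Real.exp (-2 * Real.pi * M)) K with hSdef
  have hS : IsOpen S := isOpen_puncturedPolydisc hK _
  have hH : IsOpen (halfPlaneProd k M K) := isOpen_halfPlaneProd hK
  have hz : ∀ z ∈ S, ∀ i : Fin d, (i : ℕ) < k → z i ≠ 0 := fun z hz => hz.2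
  have hP : ∀ z ∈ S, 1 ≤ logLogProd k z := one_le_logLogProd hz hr
  have hmaps : Set.MapsTo (expCover k) (halfPlaneProd k M K) S := mapsTo_expCover
  have hP' : ∀ x ∈ halfPlaneProd k M K, 1 ≤ logLogProd k (expCover k x) :=
    fun x hx => hP _ (hmaps hx)
  have hc := logLogWeight_ne_zero hz hr
  have hcs : ∀ a, ContDiffOn ℝ ∞ (logLogWeight k a) S := contDiffOn_logLogWeight hz
  obtain ⟨f, hf, hpull⟩ := h
  -- The functions `f` on the cover need not be invariant under x_i ↦ x_i + 1, so coefficients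
  -- downstairs are obtained from η itself.
  let F : (Fin n → Fin d × Bool) → Cn d → ℂ := fun r z => (n.factorial : ℂ)⁻¹ *
    η z (fun j => Pi.single (r j).1 (logLogWeight k ((r j).1, false) z * realUnit (r j).2))
  have hFs : ∀ r, ContDiffOn ℝ ∞ (F r) S := fun r =>
    contDiffOn_const.mul (contDiffOn_altForm_apply hη fun j =>
      (ContinuousLinearMap.single ℝ (fun _ : Fin d => ℂ) (r j).1).contDiff.comp_contDiffOn
        ((hcs _).mul contDiffOn_const))
  let e : Fin d × Bool → ℂ := fun b =>
    (if (b.1 : ℕ) < k then -Complex.I else 1) * realUnit b.2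
  -- The pairing of the coframe on the cover with the lifted frame vectors Im x · e b; the factors
  -- Im x cancel, so it is constant.
  let θ : Fin d × Bool → Fin d × Bool → ℂ := fun a b =>
    if a.1 = b.1 then (if a.2 then (starRingEnd ℂ) (e b) else e b) else 0
  have hvec : ∀ x ∈ halfPlaneProd k M K, ∀ b : Fin d × Bool,
      (Pi.single b.1 (logLogWeight k (b.1, false) (expCover k x) * realUnit b.2) : Cn d) =
        expDeriv k x (Pi.single b.1 (imWeight k (b.1, false) x * e b)) := by
    intro x hx b
    ext i
    rw [expDeriv_apply]
    by_cases hi : i = b.1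
    · subst hi
      rw [Pi.single_eq_same, Pi.single_eq_same, logLogWeight_expCover]
      simp only [e, Bool.false_eq_true, if_false]
      ring
    · rw [Pi.single_eq_of_ne hi, Pi.single_eq_of_ne hi, mul_zero]
  have hframe : ∀ x ∈ halfPlaneProd k M K, ∀ a b : Fin d × Bool,
      imLogFrame k a x (Pi.single b.1 (imWeight k (b.1, false) x * e b)) = θ a b := by
    intro x hx a b
    have hne : imWeight k a x ≠ 0 := by
      unfold imWeight
      split_ifs with ha
      · exact_mod_cast (one_pos.trans (hM.trans (hx.1 _ ha))).ne'
      · exact one_ne_zero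
    have hreal : (starRingEnd ℂ) (imWeight k a x) = imWeight k a x := by
      unfold imWeight
      split_ifs <;> simp
    rw [imLogFrame_eq, smul_apply, smul_eq_mul]
    by_cases hab : a.1 = b.1
    · have h1 : imWeight k (b.1, false) x = imWeight k a x := by simp [imWeight, hab]
      rw [h1]
      simp only [θ, covector, hab, if_true]
      cases a.2
      · simp [dz_apply, hne]
      · simp [dzbar_apply, hreal, hne]
    · simp only [θ, covector, hab, if_false]
      cases a.2 <;> simp [dz_apply, dzbar_apply, hab]
  have hF : ∀ r, Tame S (logLogProd k) (logLogWeight k) (F r) := by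
    intro r m
    refine TameOfOrder.of_comp hS hH hP surjOn_expCover hmaps hcs
      (fun a x g _ hg => wirt_comp_expCover k a x g hg)
      (fun a x _ => logLogWeight_expCover k a x) (hFs r) ?_
    -- The pull-back of `F r`: a combination of the `f t` whose constants are determinants in θ.
    have ht : Tame (halfPlaneProd k M K) (logLogProd k ∘ expCover k) (imWeight k)
        (fun x => ∑ t, ((n.factorial : ℂ)⁻¹ *
          Matrix.det (Matrix.of fun i j => θ (t i) (r j))) * f t x) :=
      Tame.sum hH hP' _ fun t _ =>
        (tame_const hH _).mul hH hP' (tame_of_mem_imLogFunctions hK hM hP' (hf t))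
    refine (ht m).congr hH fun x hx => ?_
    simp only [F, Function.comp_apply, hvec x hx]
    have h1 : η (expCover k x) (fun j => expDeriv k x
        (Pi.single (r j).1 (imWeight k ((r j).1, false) x * e (r j)))) =
        pullbackExp k η x
          (fun j => Pi.single (r j).1 (imWeight k ((r j).1, false) x * e (r j))) := by
      rw [pullbackExp, (hasFDerivAt_expCover k x).fderiv]
      rfl
    rw [h1, hpull x hx, ContinuousAlternatingMap.sum_apply, Finset.mul_sum]
    refine Finset.sum_congr rfl fun t _ => ?_
    rw [ContinuousAlternatingMap.smul_apply, smul_eq_mul, wedge_apply]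
    simp only [hframe x hx]
    ring
  refine isGeneratedBy_of_sum hS hP hF (fun r j a => realCoframeMatrix (r j) a) fun z hzS => ?_
  refine eq_sum_wedge_rescaled (fun a => logLogWeight k a z) (fun a => hc a z hzS)
    (fun i => ?_) (η z)
  by_cases hi : (i : ℕ) < k <;>
    simp [logLogWeight, coordWeight, logWeight, hi, covector, dz_apply, dzbar_apply]

end Covering

/-! ### Shrinking adapted charts and returning to log-log growth -/

section Charts

variable {d : ℕ} {X : Type*} [TopologicalSpace X] [ChartedSpace (Cn d) X]

/-- Shrinking of an adapted chart whose image is `(Δ_r)^k × K`. -/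
theorem IsAdaptedChart.exists_shrink {D W : Set X} {k : ℕ}
    {φ : OpenPartialHomeomorph X (Cn d)} {r r' : ℝ} {K : Set ({i : Fin d // k ≤ (i : ℕ)} → ℂ)}
    (h : IsAdaptedChart D k φ) (hW : φ.source ⊆ W) {p : X} (hp : p ∈ φ.source)
    (hp0 : ∀ i : Fin d, (i : ℕ) < k → φ p i = 0) (ht : φ.target = polydiscProd k r K)
    (hr' : 0 < r') (hrr' : r' ≤ r) :
    ∃ ψ : OpenPartialHomeomorph X (Cn d), IsAdaptedChart D k ψ ∧ p ∈ ψ.source ∧ ψ.source ⊆ W ∧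
      complementIn D ψ = puncturedPolydisc k r' K ∧
      puncturedPolydisc k r' K ⊆ complementIn D φ ∧
      ∀ (n : ℕ) (η : DForm d X n), localExpr η ψ = localExpr η φ := by
  let B : Set (Cn d) := {z | ∀ i : Fin d, (i : ℕ) < k → ‖z i‖ < r'}
  have hB : IsOpen B := by
    have : B = ⋂ i : Fin d, {z | (i : ℕ) < k → ‖z i‖ < r'} := by ext; simp [B]
    rw [this]
    refine isOpen_iInter_of_finite fun i => ?_
    by_cases hi : (i : ℕ) < k
    · simp only [hi, true_imp_iff]
      exact isOpen_lt (continuous_apply i).norm continuous_const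
    · simp [hi]
  let U : Set X := φ.source ∩ φ ⁻¹' B
  have hU : IsOpen U := φ.isOpen_inter_preimage hB
  have hsource : (φ.restr U).source = U := by
    rw [φ.restr_source' _ hU]
    exact Set.inter_eq_right.2 Set.inter_subset_left
  have hsub : (φ.restr U).source ⊆ φ.source := hsource ▸ Set.inter_subset_left
  have htarget : ∀ z, z ∈ (φ.restr U).target ↔ z ∈ φ.target ∧ z ∈ B := by
    intro z
    have e : z ∈ (φ.restr U).target ↔ z ∈ φ.target ∧ φ.symm z ∈ interior U := Iff.rfl
    rw [e, hU.interior_eq]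
    refine and_congr_right fun hz => ?_
    simp only [U, Set.mem_inter_iff, Set.mem_preimage, φ.right_inv hz, φ.map_target hz, true_and]
  have hprod : ∀ z : Cn d, ∏ i ∈ divIdx d k, z i = 0 ↔ ¬∀ i : Fin d, (i : ℕ) < k → z i ≠ 0 := by
    intro z
    rw [Finset.prod_eq_zero_iff]
    push Not
    simp only [mem_divIdx]
  have hD : ∀ z ∈ φ.target, φ.symm z ∉ D ↔ ∀ i : Fin d, (i : ℕ) < k → z i ≠ 0 := by
    intro z hz
    rw [h.1.2.2 _ (φ.map_target hz), φ.right_inv hz, hprod, not_not]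
  have hle : ∀ z, z ∈ φ.target ∧ z ∈ B ↔ z ∈ polydiscProd k r' K := by
    intro z
    rw [ht]
    exact ⟨fun hz => ⟨hz.2, hz.1.2⟩,
      fun hz => ⟨⟨fun i hi => (hz.1 i hi).trans_le hrr', hz.2⟩, hz.1⟩⟩
  -- Restriction keeps the inverse map, so local expressions agree by definition; p stays in the
  -- domain because its first k coordinates vanish.
  refine ⟨φ.restr U, ⟨⟨?_, h.1.2.1, fun x hx => h.1.2.2 x (hsub hx)⟩, fun x hx => h.2 x (hsub hx)⟩,
    ?_, hsub.trans hW, ?_, ?_, fun n η => rfl⟩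
  · exact restr_mem_maximalAtlas _ h.1.1 hU
  · rw [hsource]
    refine ⟨hp, fun i hi => ?_⟩
    rw [hp0 i hi, norm_zero]
    exact hr'
  · ext z
    change z ∈ (φ.restr U).target ∧ φ.symm z ∉ D ↔ _
    rw [htarget]
    constructor
    · rintro ⟨hz, hzD⟩
      exact ⟨(hle z).1 hz, (hD z hz.1).1 hzD⟩
    · rintro ⟨hz, hz0⟩
      have hz' := (hle z).2 hz
      exact ⟨hz', (hD z hz'.1).2 hz0⟩
  · rintro z ⟨hz, hz0⟩
    have hz' := (hle z).2 hz
    exact ⟨hz'.1, (hD z hz'.1).2 hz0⟩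

/-- The algebra generated by the tame functions consists of forms with log-log growth. -/
theorem IsGeneratedBy.hasLogLogGrowthOn {n k : ℕ} {S : Set (Cn d)} (hS : IsOpen S)
    (hz : ∀ z ∈ S, ∀ i : Fin d, (i : ℕ) < k → z i ≠ 0)
    (hr : ∀ z ∈ S, ∀ i : Fin d, ‖z i‖ ≤ 1 / Real.exp (Real.exp 1)) {η : Cn d → AltForm d n}
    (h : IsGeneratedBy {f | Tame S (logLogProd k) (logLogWeight k) f}
      (fun a z => (logLogWeight k a z)⁻¹ • covector a) S η) : HasLogLogGrowthOn k S η := by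
  obtain ⟨f, hf, hη⟩ := h
  refine ⟨f, fun s => Tame.mem_logLogFunctions hS hz hr (hf s), fun z hzS => ?_⟩
  simp only [logLogFrame_eq]
  exact hη z hzS

end Charts

end LogLog

end

/-! ### Assembly of the inclusion -/

theorem mainTheorem11 {d : ℕ} {X : Type*} [TopologicalSpace X] [ChartedSpace (Fin d → ℂ) X]
    [IsManifold 𝓘(ℂ, Fin d → ℂ) ω X] (D : Set X) (hD : LogLog.IsNormalCrossingDivisor d D)
    (W : Set X) (hW : IsOpen W) (n : ℕ) :
    LogLog.univCoverLogForms (d := d) D W n ⊆ LogLog.logLogForms D W n := by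
  rintro η ⟨hsmooth, hη⟩
  -- A single chart serves the form and its derivatives, by stability of the tame algebra.
  have key : ∀ p ∈ W, ∃ (k : ℕ) (ψ : OpenPartialHomeomorph X (LogLog.Cn d)),
      LogLog.IsAdaptedChart D k ψ ∧ p ∈ ψ.source ∧ ψ.source ⊆ W ∧
      LogLog.HasLogLogGrowthOn k (LogLog.complementIn D ψ) (LogLog.localExpr η ψ) ∧
      (∀ b, LogLog.HasLogLogGrowthOn k (LogLog.complementIn D ψ)
        (LogLog.dolbeault b (LogLog.localExpr η ψ))) ∧
      ∀ b b', LogLog.HasLogLogGrowthOn k (LogLog.complementIn D ψ)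
        (LogLog.dolbeault b (LogLog.dolbeault b' (LogLog.localExpr η ψ))) := by
    intro p hp
    obtain ⟨k, φ, r, M, K, hφ, hpφ, hφW, hp0, hr0, hK, htarget, hM, hMr, hgrowth⟩ := hη p hp
    -- The half plane Im x > M covers only the punctured disc of radius e^{-2πM}. It lies in Δ_r
    -- because -2πM ≤ -M < log r.
    have hrM : Real.exp (-2 * Real.pi * M) ≤ r := by
      rw [← Real.le_log_iff_exp_le hr0]
      rw [one_div, Real.log_inv] at hMr
      nlinarith [Real.pi_gt_three]
    obtain ⟨ψ, hψ, hpψ, hψW, hcompl, hsub, hexpr⟩ :=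
      hφ.exists_shrink hφW hpφ hp0 htarget (Real.exp_pos _) hrM
    have hS := LogLog.isOpen_puncturedPolydisc (k := k) hK (Real.exp (-2 * Real.pi * M))
    have hz : ∀ z ∈ LogLog.puncturedPolydisc k (Real.exp (-2 * Real.pi * M)) K,
        ∀ i : Fin d, (i : ℕ) < k → z i ≠ 0 := fun z hz => hz.2
    have hr : ∀ z ∈ LogLog.puncturedPolydisc k (Real.exp (-2 * Real.pi * M)) K,
        ∀ i : Fin d, ‖z i‖ ≤ 1 / Real.exp (Real.exp 1) := by
      intro z hz i
      have h1 := hsub hz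
      have h2 := hφ.2 _ (φ.map_target h1.1) i
      rwa [φ.right_inv h1.1] at h2
    have hηs : ContDiffOn ℝ ∞ (LogLog.localExpr η φ)
        (LogLog.puncturedPolydisc k (Real.exp (-2 * Real.pi * M)) K) := by
      refine (hsmooth φ hφ.1.1).mono fun z hz => ?_
      have h1 := hsub hz
      exact ⟨h1.1, hφW (φ.map_target h1.1), h1.2⟩
    have hgen := LogLog.isGeneratedBy_of_hasImLogGrowthOn hK hM hr hηs hgrowth
    have hstable : ∀ {m : ℕ} {ζ : LogLog.Cn d → LogLog.AltForm d m}, _ → ∀ b, _ :=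
      fun {m} {ζ} (h : LogLog.IsGeneratedBy _ _ _ ζ) b =>
        h.dolbeault hS (LogLog.one_le_logLogProd hz hr) (LogLog.contDiffOn_logLogWeight hz)
          (LogLog.logLogWeight_ne_zero hz hr) (LogLog.isWeight_logLogWeight hS hz) b
    refine ⟨k, ψ, hψ, hpψ, hψW, ?_⟩
    rw [hcompl, hexpr]
    exact ⟨hgen.hasLogLogGrowthOn hS hz hr,
      fun b => (hstable hgen b).hasLogLogGrowthOn hS hz hr,
      fun b b' => (hstable (hstable hgen b') b).hasLogLogGrowthOn hS hz hr⟩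
  refine ⟨hsmooth, fun p hp => ?_, fun p hp => ?_, fun p hp => ?_, fun p hp => ?_⟩ <;>
    obtain ⟨k, ψ, h1, h2, h3, h4, h5, h6⟩ := key p hp
  · exact ⟨k, ψ, h1, h2, h3, h4⟩
  · exact ⟨k, ψ, h1, h2, h3, h5 false⟩
  · exact ⟨k, ψ, h1, h2, h3, h5 true⟩
  · exact ⟨k, ψ, h1, h2, h3, h6 false true⟩
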